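/- Let $H$ be a complex inner product space (for example, the complexification of a separable real Hilbert space), with $\langle\cdot,\cdot\rangle$ linear in the second and conjugate-linear in the first variable, and let $x\mapsto\bar x$ be a self-adjoint involution of $H$, that is, a $\mathbb C$-linear map with $\overline{\bar x}=x$ and $\langle \bar x,y\rangle=\langle x,\bar y\rangle$. Let $\alpha,q\in(-1,1)$, with the convention $0^0=1$. Let $\Sigma(n)$ be the group of bijections $\sigma$ of $\{\pm1,\dots,\pm n\}$ with $\sigma(-k)=-\sigma(k)$. It is generated by $\pi_0=(1,-1)$ and $\pi_i=(i,i+1)$, $1\le i\le n-1$ (with $\pi_i$ also exchanging $-i$ and $-(i+1)$). Let $l_1(\sigma)$ be the number of occurrences of $\pi_0$, and $l_2(\sigma)$ the number of occurrences of $\pi_1,\dots,\pi_{n-1}$, in an expression of minimal length of $\sigma$ as a product of generators; these numbers do not depend on the expression. The group $\Sigma(n)$ acts on the algebraic tensor power $H^{\otimes n}$: $\pi_0$ replaces $x_1$ in $x_1\otimes\cdots\otimes x_n$ by $\overline{x_1}$, and $\pi_i$ exchanges the factors $x_i$ and $x_{i+1}$. Put $$P^{(n)}_{\alpha,q}=\sum_{\sigma\in\Sigma(n)}\alpha^{l_1(\sigma)}q^{l_2(\sigma)}\,\sigma\quad(n\ge1),\qquad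 P^{(0)}_{\alpha,q}=\mathrm{id}.$$ On the algebraic full Fock space $\mathcal F=\bigoplus_{n\ge0}H^{\otimes n}$, where $H^{\otimes0}=\mathbb C\Omega$, let $\langle\cdot,\cdot\rangle_{0,0}$ be the sesquilinear form with $\langle x_1\otimes\cdots\otimes x_m,y_1\otimes\cdots\otimes y_n\rangle_{0,0}=\delta_{m,n}\prod_{i=1}^n\langle x_i,y_i\rangle$, and let $\langle f,g\rangle_{\alpha,q}=\langle f,P_{\alpha,q}g\rangle_{0,0}$, where $P_{\alpha,q}=\bigoplus_n P^{(n)}_{\alpha,q}$. For $x\in H$ let $b^*(x)$ be the right creation operator $x_1\otimes\cdots\otimes x_n\mapsto x_1\otimes\cdots\otimes x_n\otimes x$, $\Omega\mapsto x$. Let $N$ be the number operator ($Nf=nf$ for $f\in H^{\otimes n}$), and for real $s$ define operators that vanish on $\Omega$ and satisfy, for $n\ge1$, $$r_s(x)(x_1\otimes\cdots\otimes x_n)=\sum_{k=1}^n s^{n-k}\langle x,x_k\rangle\,x_1\otimes\cdots\otimes\check x_k\otimes\cdots\otimes x_n,$$ $$\ell_s(x)(x_1\otimes\cdots\otimes x_n)=\sum_{k=1}^n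 s^{k-1}\langle x,x_k\rangle\,x_1\otimes\cdots\otimes\check x_k\otimes\cdots\otimes x_n,$$ where $\check x_k$ means that the factor $x_k$ is omitted. Then, for every $x\in H$, the operator $b^*(x)$ has exactly one adjoint $b(x)$ on $\mathcal F$ with respect to $\langle\cdot,\cdot\rangle_{\alpha,q}$, that is, exactly one linear operator $b(x)$ on $\mathcal F$ with $\langle f,b(x)g\rangle_{\alpha,q}=\langle b^*(x)f,g\rangle_{\alpha,q}$ for all $f,g\in\mathcal F$, and $$b(x)=r_q(x)+\alpha\,\ell_q(\bar x)\,q^{N-1}.$$ (For $q=0$ the undefined value of $q^{N-1}$ on $\Omega$ is immaterial, since $\ell_q(\bar x)\Omega=0$.) Moreover, $r_0(x)$ is the free right annihilation operator ($x_1\otimes\cdots\otimes x_n\mapsto\langle x,x_n\rangle\,x_1\otimes\cdots\otimes x_{n-1}$ for $n\ge1$, $\Omega\mapsto0$), $\ell_0(x)$ is the free left annihilation operator ($x_1\otimes\cdots\otimes x_n\mapsto\langle x,x_1\rangle\,x_2\otimes\cdots\otimes x_n$ for $n\ge1$, $\Omega\mapsto0$), and $\ell_q(x)=r_{1/q}(x)\,q^{N-1}$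 if $q\ne0$. -/

import Mathlib

namespace TypeB

open scoped TensorProduct DirectSum

/-! ## The hyperoctahedral group -/

/-- The `2n` points `{±1, …, ±n}`: the pair `(k, ε)` stands for the point `ε (k + 1)`. -/
abbrev SignedPoint (n : ℕ) : Type := Fin n × ℤˣ

/-- The hyperoctahedral group `Σ(n)`: the bijections `σ` of `{±1, …, ±n}` with `σ(-p) = -σ(p)`;
the product is composition. -/
def hyperoctahedral (n : ℕ) : Subgroup (Equiv.Perm (SignedPoint n)) where
  carrier := {σ | ∀ k ε, σ (k, -ε) = ((σ (k, ε)).1, -(σ (k, ε)).2)}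
  one_mem' := by intro k ε; rfl
  mul_mem' := by
    intro σ τ hσ hτ k ε
    have h := hσ (τ (k, ε)).1 (τ (k, ε)).2
    rw [Equiv.Perm.mul_apply, Equiv.Perm.mul_apply, hτ k ε]
    exact h
  inv_mem' := by
    intro σ hσ k ε
    rw [Equiv.Perm.inv_eq_iff_eq]
    have h := hσ (σ⁻¹ (k, ε)).1 (σ⁻¹ (k, ε)).2
    have e : σ (σ⁻¹ (k, ε)) = (k, ε) := σ.apply_symm_apply _
    rw [Prod.mk.eta, e] at h
    exact h.symm

noncomputable instance (n : ℕ) : Fintype (hyperoctahedral n) := Fintype.ofFinite _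

theorem apply_neg {n : ℕ} (σ : hyperoctahedral n) (k : Fin n) (ε : ℤˣ) :
    σ.1 (k, -ε) = ((σ.1 (k, ε)).1, -(σ.1 (k, ε)).2) := σ.2 k ε

theorem apply_eq {n : ℕ} (σ : hyperoctahedral n) (k : Fin n) (ε : ℤˣ) :
    σ.1 (k, ε) = ((σ.1 (k, 1)).1, ε * (σ.1 (k, 1)).2) := by
  rcases Int.units_eq_one_or ε with rfl | rfl
  · simp
  · rw [apply_neg σ k 1]; simp

/-- The sign change `(k, -k)`. -/
def signFlip {n : ℕ} (k : Fin n) : hyperoctahedral n :=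
  ⟨Equiv.swap (k, 1) (k, -1), by
    intro j ε
    rcases Int.units_eq_one_or ε with rfl | rfl <;> by_cases h : j = k
    · subst h; simp
    · rw [Equiv.swap_apply_of_ne_of_ne, Equiv.swap_apply_of_ne_of_ne] <;> simp [h]
    · subst h; simp
    · rw [Equiv.swap_apply_of_ne_of_ne, Equiv.swap_apply_of_ne_of_ne] <;> simp [h]⟩

/-- The embedding of the symmetric group `S(n)` in `Σ(n)`. -/
def ofPerm {n : ℕ} : Equiv.Perm (Fin n) →* hyperoctahedral n where
  toFun τ := ⟨τ.prodCongr (Equiv.refl ℤˣ), by intro k ε; rfl⟩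
  map_one' := rfl
  map_mul' _ _ := rfl

theorem ofPerm_apply {n : ℕ} (τ : Equiv.Perm (Fin n)) (k : Fin n) (ε : ℤˣ) :
    (ofPerm τ).1 (k, ε) = (τ k, ε) := rfl

/-- The Coxeter generators `π_0 = (1, -1)` and `π_i = (i, i + 1)` for `1 ≤ i ≤ n - 1`, where
the point `i` of `{1, …, n}` is written `i - 1` in `Fin n`. -/
def gen {n : ℕ} (i : Fin n) : hyperoctahedral n :=
  if i.val = 0 then signFlip i
  else ofPerm (Equiv.swap ⟨i.val - 1, lt_of_le_of_lt (Nat.sub_le _ _) i.isLt⟩ i)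

/-- `w = [i_1, …, i_k]` is an irreducible form `σ = π_{i_1} ⋯ π_{i_k}` of `σ`: no word in the
generators that represents `σ` is shorter. -/
def IsReducedWord {n : ℕ} (σ : hyperoctahedral n) (w : List (Fin n)) : Prop :=
  (w.map gen).prod = σ ∧ ∀ w' : List (Fin n), (w'.map gen).prod = σ → w.length ≤ w'.length

theorem ofPerm_mem (n : ℕ) (τ : Equiv.Perm (Fin n)) :
    ofPerm τ ∈ Submonoid.closure (Set.range (gen : Fin n → hyperoctahedral n)) := by
  cases n with
  | zero =>
    have : τ = 1 := Subsingleton.elim _ _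
    rw [this, map_one]; exact one_mem _
  | succ m =>
    have h : τ ∈ Submonoid.closure
        (Set.range fun i : Fin m => Equiv.swap i.castSucc i.succ) := by
      rw [Equiv.Perm.mclosure_swap_castSucc_succ]; trivial
    refine Submonoid.closure_induction (motive := fun τ _ => ofPerm τ ∈ _) ?_ ?_ ?_ h
    · rintro _ ⟨i, rfl⟩
      refine Submonoid.subset_closure ⟨i.succ, ?_⟩
      simp only [gen, Fin.val_succ, Nat.add_eq_zero_iff, one_ne_zero, and_false, if_false]
      rfl
    · rw [map_one]; exact one_mem _
    · intro a b _ _ ha hb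
      rw [map_mul]; exact mul_mem ha hb

theorem signFlip_mem {n : ℕ} (k : Fin n) :
    signFlip k ∈ Submonoid.closure (Set.range (gen : Fin n → hyperoctahedral n)) := by
  have hn : 0 < n := lt_of_le_of_lt (Nat.zero_le _) k.isLt
  set z : Fin n := ⟨0, hn⟩ with hz
  have hg : gen z = signFlip z := by simp [gen, hz]
  have h : signFlip k = ofPerm (Equiv.swap z k) * gen z * ofPerm (Equiv.swap z k) := by
    rw [hg]
    apply Subtype.ext
    have := Equiv.swap_apply_apply ((Equiv.swap z k).prodCongr (Equiv.refl ℤˣ)) (z, 1) (z, -1)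
    simp only [Equiv.prodCongr_apply, Prod.map_apply, Equiv.swap_apply_left,
      Equiv.refl_apply] at this
    simp only [signFlip, Subgroup.coe_mul]
    rw [this]
    congr 1
  rw [h]
  exact mul_mem (mul_mem (ofPerm_mem n _) (Submonoid.subset_closure ⟨z, rfl⟩)) (ofPerm_mem n _)

/-- The permutation `k ↦ |σ(k)|` of `{1, …, n}` underlying `σ ∈ Σ(n)`. -/
def absPerm {n : ℕ} (σ : hyperoctahedral n) : Equiv.Perm (Fin n) where
  toFun k := (σ.1 (k, 1)).1
  invFun k := (σ⁻¹.1 (k, 1)).1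
  left_inv k := by
    have h : σ⁻¹.1 (σ.1 (k, 1)) = (k, 1) := σ.1.symm_apply_apply _
    rw [← Prod.mk.eta (p := σ.1 (k, 1)), apply_eq] at h
    exact congrArg Prod.fst h
  right_inv k := by
    have h : σ.1 (σ⁻¹.1 (k, 1)) = (k, 1) := σ.1.apply_symm_apply _
    rw [← Prod.mk.eta (p := σ⁻¹.1 (k, 1)), apply_eq] at h
    exact congrArg Prod.fst h

theorem mem_closure_gen {n : ℕ} (σ : hyperoctahedral n) :
    σ ∈ Submonoid.closure (Set.range (gen : Fin n → hyperoctahedral n)) := by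
  suffices H : ∀ (m : ℕ) (σ : hyperoctahedral n),
      (Finset.univ.filter fun k => (σ.1 (k, 1)).2 = -1).card = m →
      σ ∈ Submonoid.closure (Set.range (gen : Fin n → hyperoctahedral n)) from H _ σ rfl
  intro m
  induction m with
  | zero =>
    intro σ h
    have h1 : ∀ k, (σ.1 (k, 1)).2 = 1 := by
      intro k
      have := Finset.filter_eq_empty_iff.1 (Finset.card_eq_zero.1 h) (Finset.mem_univ k)
      exact (Int.units_eq_one_or _).resolve_right this
    have : σ = ofPerm (absPerm σ) := by
      apply Subtype.ext
      apply Equiv.ext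
      rintro ⟨k, ε⟩
      rw [apply_eq, h1 k, ofPerm_apply, mul_one]
      rfl
    rw [this]; exact ofPerm_mem n _
  | succ m ih =>
    intro σ h
    obtain ⟨k, hk⟩ := Finset.card_pos.1 (by rw [h]; exact Nat.succ_pos m)
    have hk' := (Finset.mem_filter.1 hk).2
    have hs : (σ * signFlip k) * signFlip k = σ := by
      apply Subtype.ext
      simp [signFlip, mul_assoc]
    rw [← hs]
    refine mul_mem (ih _ ?_) (signFlip_mem k)
    have : (Finset.univ.filter fun j => ((σ * signFlip k).1 (j, 1)).2 = -1)
        = (Finset.univ.filter fun j => (σ.1 (j, 1)).2 = -1).erase k := by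
      ext j
      have key : (σ * signFlip k).1 (j, 1) = σ.1 (Equiv.swap (k, 1) (k, -1) (j, 1)) := rfl
      rw [Finset.mem_erase, Finset.mem_filter, Finset.mem_filter, key]
      by_cases hj : j = k
      · subst hj
        rw [Equiv.swap_apply_left, apply_neg, hk']
        simp
      · rw [Equiv.swap_apply_of_ne_of_ne] <;> simp [hj]
    rw [this, Finset.card_erase_of_mem hk, h]
    rfl

theorem exists_reducedWord {n : ℕ} (σ : hyperoctahedral n) : ∃ w, IsReducedWord σ w := by
  classical
  have hex : ∃ m, ∃ w : List (Fin n), w.length = m ∧ (w.map gen).prod = σ := by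
    obtain ⟨l, hl, hp⟩ := Submonoid.exists_list_of_mem_closure (mem_closure_gen σ)
    obtain ⟨w, rfl⟩ : ∃ w : List (Fin n), w.map gen = l := by
      have : l ∈ Set.range (List.map (gen : Fin n → hyperoctahedral n)) := by
        rw [Set.range_list_map]; exact hl
      exact this
    exact ⟨_, w, rfl, hp⟩
  obtain ⟨w, hw, hp⟩ := Nat.find_spec hex
  exact ⟨w, hp, fun w' hw' => hw ▸ Nat.find_min' hex ⟨w', rfl, hw'⟩⟩

/-- A chosen irreducible form of `σ`. -/
noncomputable def reducedWord {n : ℕ} (σ : hyperoctahedral n) : List (Fin n) :=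
  (exists_reducedWord σ).choose

/-- `l₁(σ)`: the number of `π_0` in an irreducible form of `σ`. All irreducible forms of `σ`
give the same number, so the choice of the form does not matter; the same holds for `l₂(σ)`. -/
noncomputable def lOne {n : ℕ} (σ : hyperoctahedral n) : ℕ :=
  (reducedWord σ).countP fun i => i.val = 0

/-- `l₂(σ)`: the number of `π_i`, `1 ≤ i ≤ n - 1`, in an irreducible form of `σ`. -/
noncomputable def lTwo {n : ℕ} (σ : hyperoctahedral n) : ℕ :=
  (reducedWord σ).countP fun i => i.val ≠ 0

/-! ## The algebraic full Fock space -/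

section Fock

variable {H : Type*} [NormedAddCommGroup H] [InnerProductSpace ℂ H]

/-- The operator by which a sign acts on `H`: `id` for the sign `1` and the involution `J` for the sign `-1`. -/
def signOp (J : H →ₗ[ℂ] H) (ε : ℤˣ) : H →ₗ[ℂ] H := if ε = 1 then LinearMap.id else J

/-- The action of `σ ∈ Σ(n)` on `H^{⊗n}`. With `x_{-k} := J x_k`, it sends `x_1 ⊗ ⋯ ⊗ x_n` to
`x_{σ⁻¹(1)} ⊗ ⋯ ⊗ x_{σ⁻¹(n)}`. -/
noncomputable def act (J : H →ₗ[ℂ] H) {n : ℕ} (σ : hyperoctahedral n) :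
    (⨂[ℂ]^n H) →ₗ[ℂ] (⨂[ℂ]^n H) :=
  PiTensorProduct.map (fun i => signOp J (σ⁻¹.1 (i, 1)).2) ∘ₗ
    (PiTensorProduct.reindex ℂ (fun _ : Fin n => H) (absPerm σ)).toLinearMap

theorem act_tprod (J : H →ₗ[ℂ] H) {n : ℕ} (σ : hyperoctahedral n) (v : Fin n → H) :
    act J σ (PiTensorProduct.tprod ℂ v) = PiTensorProduct.tprod ℂ
      fun i => signOp J (σ⁻¹.1 (i, 1)).2 (v (σ⁻¹.1 (i, 1)).1) := by
  have h : PiTensorProduct.reindex ℂ (fun _ : Fin n => H) (absPerm σ)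
      (PiTensorProduct.tprod ℂ v) =
      PiTensorProduct.tprod ℂ (fun i => v ((absPerm σ).symm i)) :=
    PiTensorProduct.reindex_tprod (absPerm σ) v
  rw [act, LinearMap.comp_apply, LinearEquiv.coe_coe, h]
  exact PiTensorProduct.map_tprod _ _

theorem act_one (J : H →ₗ[ℂ] H) {n : ℕ} :
    act J (1 : hyperoctahedral n) = LinearMap.id := by
  apply PiTensorProduct.ext
  ext v
  simp only [LinearMap.compMultilinearMap_apply, act_tprod, LinearMap.id_apply]
  congr 1

theorem act_mul (J : H →ₗ[ℂ] H) (hJ : Function.Involutive J) {n : ℕ}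
    (σ τ : hyperoctahedral n) : act J (σ * τ) = act J σ ∘ₗ act J τ := by
  have hs : ∀ (ε δ : ℤˣ) (x : H), signOp J ε (signOp J δ x) = signOp J (ε * δ) x := by
    intro ε δ x
    rcases Int.units_eq_one_or ε with rfl | rfl <;>
      rcases Int.units_eq_one_or δ with rfl | rfl <;> simp [signOp, hJ x]
  apply PiTensorProduct.ext
  ext v
  simp only [LinearMap.compMultilinearMap_apply, act_tprod, LinearMap.comp_apply, hs]
  congr 1
  funext i
  have h : (σ * τ)⁻¹.1 (i, 1) = τ⁻¹.1 ((σ⁻¹.1 (i, 1)).1, (σ⁻¹.1 (i, 1)).2) := by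
    rw [mul_inv_rev]; rfl
  rw [h, apply_eq τ⁻¹]

/-- `π_0 (x_1 ⊗ ⋯ ⊗ x_n) = x̄_1 ⊗ x_2 ⊗ ⋯ ⊗ x_n`. -/
theorem act_gen_zero (J : H →ₗ[ℂ] H) {n : ℕ} (i : Fin n) (hi : i.val = 0) (v : Fin n → H) :
    act J (gen i) (PiTensorProduct.tprod ℂ v) =
      PiTensorProduct.tprod ℂ (Function.update v i (J (v i))) := by
  rw [act_tprod]
  congr 1
  funext j
  have hg : (gen i)⁻¹.1 = Equiv.swap (i, 1) (i, -1) := by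
    simp [gen, hi, signFlip]
  rw [hg]
  by_cases hj : j = i
  · subst hj
    simp [signOp]
  · rw [Equiv.swap_apply_of_ne_of_ne] <;> simp [signOp, hj]

/-- `π_i` with `i ≥ 1` exchanges the tensor factors `i` and `i + 1`. -/
theorem act_gen_pos (J : H →ₗ[ℂ] H) {n : ℕ} (i : Fin n) (hi : i.val ≠ 0) (v : Fin n → H) :
    act J (gen i) (PiTensorProduct.tprod ℂ v) = PiTensorProduct.tprod ℂ
      (v ∘ Equiv.swap ⟨i.val - 1, lt_of_le_of_lt (Nat.sub_le _ _) i.isLt⟩ i) := by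
  rw [act_tprod]
  congr 1
  funext j
  rw [gen, if_neg hi, ← map_inv, Equiv.swap_inv, ofPerm_apply]
  simp [signOp]

/-- The type B symmetrization operator
`P^{(n)} = ∑_{σ ∈ Σ(n)} α^{l₁(σ)} q^{l₂(σ)} σ` on `H^{⊗n}`. -/
noncomputable def symmetrizer (J : H →ₗ[ℂ] H) (α q : ℝ) (n : ℕ) :
    (⨂[ℂ]^n H) →ₗ[ℂ] (⨂[ℂ]^n H) :=
  ∑ σ : hyperoctahedral n, ((α ^ lOne σ * q ^ lTwo σ : ℝ) : ℂ) • act J σ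

/-- The linear functional `y_1 ⊗ ⋯ ⊗ y_n ↦ ∏ ⟨v_i, y_i⟩` on `H^{⊗n}`. -/
noncomputable def innerFunctional {n : ℕ} (v : Fin n → H) : (⨂[ℂ]^n H) →ₗ[ℂ] ℂ :=
  PiTensorProduct.lift
    ((MultilinearMap.mkPiAlgebra ℂ (Fin n) ℂ).compLinearMap fun i => innerₛₗ ℂ (v i))

theorem innerFunctional_tprod {n : ℕ} (v y : Fin n → H) :
    innerFunctional v (PiTensorProduct.tprod ℂ y) = ∏ i, inner ℂ (v i) (y i) := by
  simp [innerFunctional]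

/-- The inner product of `H^{⊗n}`, conjugate-linear in the first variable, with
`⟨x_1 ⊗ ⋯ ⊗ x_n, y_1 ⊗ ⋯ ⊗ y_n⟩ = ∏ ⟨x_i, y_i⟩`. -/
noncomputable def tensorInner (n : ℕ) : (⨂[ℂ]^n H) →ₗ⋆[ℂ] (⨂[ℂ]^n H) →ₗ[ℂ] ℂ where
  toFun := PiTensorProduct.liftAddHom
    (fun p : ℂ × (Fin n → H) => (starRingEnd ℂ) p.1 • innerFunctional p.2)
    (by
      intro r f i hf
      apply PiTensorProduct.ext
      ext y
      simp only [LinearMap.compMultilinearMap_apply, LinearMap.smul_apply, innerFunctional_tprod,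
        LinearMap.zero_apply]
      rw [Finset.prod_eq_zero (Finset.mem_univ i) (by rw [hf, inner_zero_left]), smul_zero])
    (by intro f; simp)
    (by
      intro _ r f i a b
      rw [← smul_add]
      congr 1
      apply PiTensorProduct.ext
      ext y
      simp only [LinearMap.compMultilinearMap_apply, LinearMap.add_apply, innerFunctional_tprod]
      simp only [← Finset.mul_prod_erase _ _ (Finset.mem_univ i), Function.update_self,
        inner_add_left, add_mul]
      congr 2 <;>
      exact Finset.prod_congr rfl fun j hj => by
        rw [Function.update_of_ne (Finset.ne_of_mem_erase hj),
          Function.update_of_ne (Finset.ne_of_mem_erase hj)])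
    (by intro r r' f; rw [map_add, add_smul])
    (by
      intro _ r f i c
      rw [map_mul, mul_comm, mul_smul]
      congr 1
      apply PiTensorProduct.ext
      ext y
      simp only [LinearMap.compMultilinearMap_apply, LinearMap.smul_apply, innerFunctional_tprod]
      simp only [← Finset.mul_prod_erase _ _ (Finset.mem_univ i), Function.update_self,
        inner_smul_left, smul_eq_mul, mul_assoc]
      congr 2
      exact Finset.prod_congr rfl fun j hj => by
        rw [Function.update_of_ne (Finset.ne_of_mem_erase hj)])
  map_add' := map_add _
  map_smul' := by
    intro c z
    induction z using PiTensorProduct.induction_on' with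
    | tprodCoeff r f =>
      rw [PiTensorProduct.smul_tprodCoeff']
      simp only [PiTensorProduct.tprodCoeff, PiTensorProduct.liftAddHom]
      erw [AddCon.lift_coe, AddCon.lift_coe]
      simp [mul_smul]
    | add a b ha hb => rw [smul_add, map_add, ha, hb, map_add, smul_add]

theorem tensorInner_tprod {n : ℕ} (x y : Fin n → H) :
    tensorInner n (PiTensorProduct.tprod ℂ x) (PiTensorProduct.tprod ℂ y) =
      ∏ i, inner ℂ (x i) (y i) := by
  rw [← innerFunctional_tprod, PiTensorProduct.tprod_eq_tprodCoeff_one]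
  simp only [tensorInner, LinearMap.coe_mk, AddHom.coe_mk, PiTensorProduct.tprodCoeff,
    PiTensorProduct.liftAddHom]
  erw [AddCon.lift_coe]
  simp

variable (H) in
/-- The algebraic full Fock space `⨁_n H^{⊗n}` (no completion). -/
abbrev Fock : Type _ := ⨁ n : ℕ, ⨂[ℂ]^n H

/-- The form `⟨f, g⟩_{α,q} = ⟨f, P_{α,q} g⟩_{0,0} = ∑_n ⟨f_n, P^{(n)}_{α,q} g_n⟩` on the Fock
space; the sum runs over the degrees `n` with `f_n ≠ 0`. -/
noncomputable def fockInner (J : H →ₗ[ℂ] H) (α q : ℝ) (f g : Fock H) : ℂ := by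
  classical
  exact ∑ n ∈ DFinsupp.support f, tensorInner n (f n) (symmetrizer J α q n (g n))

/-- `x_1 ⊗ ⋯ ⊗ x_n ↦ x_1 ⊗ ⋯ ⊗ x_n ⊗ x`. -/
noncomputable def appendRight (x : H) (n : ℕ) : (⨂[ℂ]^n H) →ₗ[ℂ] (⨂[ℂ]^(n + 1) H) :=
  PiTensorProduct.lift (LinearMap.compMultilinearMap (LinearMap.applyₗ x)
    (PiTensorProduct.tprod ℂ (s := fun _ : Fin (n + 1) => H)).curryRight)

theorem appendRight_tprod (x : H) {n : ℕ} (v : Fin n → H) :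
    appendRight x n (PiTensorProduct.tprod ℂ v) =
      PiTensorProduct.tprod ℂ (Fin.snoc v x : Fin (n + 1) → H) := by
  simp [appendRight]

/-- The free right creation operator `r*(x)`, which is also the type B creation operator. -/
noncomputable def creation (x : H) : Fock H →ₗ[ℂ] Fock H :=
  DirectSum.toModule ℂ ℕ (Fock H) fun n =>
    DirectSum.lof ℂ ℕ (fun n => ⨂[ℂ]^n H) (n + 1) ∘ₗ appendRight x n

/-- `T` is the type B annihilation operator of `x`, i.e. the adjoint of the creation operator
with respect to `⟨·,·⟩_{α,q}`. -/
def IsAnnihilation (J : H →ₗ[ℂ] H) (α q : ℝ) (x : H) (T : Fock H →ₗ[ℂ] Fock H) : Prop :=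
  ∀ f g : Fock H, fockInner J α q f (T g) = fockInner J α q (creation x f) g

/-- `x_1 ⊗ ⋯ ⊗ x_{n+1} ↦ ⟨x, x_k⟩ x_1 ⊗ ⋯ ⊗ x̌_k ⊗ ⋯ ⊗ x_{n+1}` (the factor `x_k` is omitted). -/
noncomputable def contract (x : H) {n : ℕ} (k : Fin (n + 1)) :
    (⨂[ℂ]^(n + 1) H) →ₗ[ℂ] (⨂[ℂ]^n H) :=
  PiTensorProduct.lift (LinearMap.uncurryMid k
    (LinearMap.smulRight (innerₛₗ ℂ x) (PiTensorProduct.tprod ℂ (s := fun _ : Fin n => H))))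

theorem contract_tprod (x : H) {n : ℕ} (k : Fin (n + 1)) (v : Fin (n + 1) → H) :
    contract x k (PiTensorProduct.tprod ℂ v) =
      inner ℂ x (v k) • PiTensorProduct.tprod ℂ (fun i => v (k.succAbove i)) := by
  simp [contract, LinearMap.uncurryMid]
  rfl

/-- The operator on the Fock space that vanishes on the vacuum and maps `H^{⊗(n+1)}` to `H^{⊗n}`
by `D n`. -/
noncomputable def lowering (D : ∀ n : ℕ, (⨂[ℂ]^(n + 1) H) →ₗ[ℂ] (⨂[ℂ]^n H)) :
    Fock H →ₗ[ℂ] Fock H :=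
  DirectSum.toModule ℂ ℕ (Fock H) fun n =>
    match n with
    | 0 => 0
    | n + 1 => DirectSum.lof ℂ ℕ (fun n => ⨂[ℂ]^n H) n ∘ₗ D n

/-- The free right annihilation operator `r(x)`, which removes the last factor. -/
noncomputable def freeRight (x : H) : Fock H →ₗ[ℂ] Fock H :=
  lowering fun n => contract x (Fin.last n)

/-- The free left annihilation operator, which removes the first factor. -/
noncomputable def freeLeft (x : H) : Fock H →ₗ[ℂ] Fock H :=
  lowering fun _ => contract x 0

/-- `r_q(x)`: on `H^{⊗(n+1)}` the `k`-th factor, `k = 0, …, n`, is removed with weight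
`q^{n-k}`. -/
noncomputable def rightAnnihilation (q : ℝ) (x : H) : Fock H →ₗ[ℂ] Fock H :=
  lowering fun n => ∑ k : Fin (n + 1), ((q : ℂ) ^ (n - k.val)) • contract x k

/-- `ℓ_q(x)`: on `H^{⊗(n+1)}` the `k`-th factor, `k = 0, …, n`, is removed with weight `q^k`. -/
noncomputable def leftAnnihilation (q : ℝ) (x : H) : Fock H →ₗ[ℂ] Fock H :=
  lowering fun n => ∑ k : Fin (n + 1), ((q : ℂ) ^ k.val) • contract x k

variable (H) in
/-- The function `φ(N)` of the number operator `N`: multiplication by `φ n` on `H^{⊗n}`. -/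
noncomputable def numberFun (φ : ℕ → ℂ) : Fock H →ₗ[ℂ] Fock H :=
  DirectSum.toModule ℂ ℕ (Fock H) fun n =>
    φ n • DirectSum.lof ℂ ℕ (fun n => ⨂[ℂ]^n H) n

variable (H) in
/-- The operator `q^{N-1}`. For `q = 0` it is `0` on the vacuum, where the exponent is `-1`. -/
noncomputable def qPowNumberSubOne (q : ℝ) : Fock H →ₗ[ℂ] Fock H :=
  numberFun H fun n => (q : ℂ) ^ ((n : ℤ) - 1)

end Fock

end TypeB

/-! The form pairs `f ⊗ x` with `g` through `P^{(n+1)}`, and for the undeformed product the adjoint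
of appending `x` is contraction of the last factor with `x`. An adjoint is therefore any operator
whose components `b_n` satisfy (contraction of the last factor) ∘ `P^{(n+1)}` = `P^{(n)}` ∘ `b_n`,
and it is unique once the form is nondegenerate.

Existence (`contract_comp_symmetrizer`). Each element of `Σ(n+1)` is uniquely a product of some `τ ∈
Σ(n)` and a coset representative, determined by the signed point `(k, ε)` that it sends to the last
point. The factor `τ` commutes with contraction of the last factor. The representative brings the
`k`-th factor to the end, so contraction after it removes that factor, paired with `x` or with `J
x`. The weight is multiplicative on this product, and the representative carries `q^{n-k}` for `ε =
1` and `α q^{n+k}` for `ε = -1`, with `k` counted from `0`. These are the coefficients of the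
formula.

The weights are found by geometry: `l₁` and `l₂` count the hyperplanes `x_i = 0` and `x_i = ± x_j`
that separate two chambers (`countP_eq_of_isReducedWord`). These counts are left-invariant and obey
the triangle inequality, so no word has fewer letters of either kind; an explicit word attains their
sum.

Uniqueness (`eq_of_fockInner_eq`). The matrix of the weights of `σ⁻¹ τ` is a product, over
hyperplanes, of kernels `1` or `c` with `|c| < 1`, hence positive definite. So the symmetrization
element is invertible in the group algebra, and `P^{(n)}` is injective whatever the dimension of
`H`; the undeformed product is nondegenerate by reduction to finite-dimensional subspaces. -/

namespace TypeB

/-! ## Separating hyperplanes -/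

/-- The integer `ε (k + 1)` for which the pair `(k, ε)` stands. -/
def value {n : ℕ} (p : SignedPoint n) : ℤ := (p.2 : ℤ) * (p.1.val + 1)

theorem value_neg {n : ℕ} (k : Fin n) (ε : ℤˣ) : value (k, -ε) = -value (k, ε) := by
  simp [value]

theorem value_one {n : ℕ} (k : Fin n) : value (k, 1) = k.val + 1 := by
  simp [value]

theorem value_neg_one {n : ℕ} (k : Fin n) : value (k, -1) = -(k.val + 1 : ℤ) := by
  simp [value]

theorem value_ne {n : ℕ} {p q : SignedPoint n} (h : p.1 ≠ q.1) : value p ≠ value q := by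
  obtain ⟨i, ε⟩ := p
  obtain ⟨j, δ⟩ := q
  have h' : i.val ≠ j.val := fun e => h (Fin.ext e)
  rcases Int.units_eq_one_or ε with rfl | rfl <;>
    rcases Int.units_eq_one_or δ with rfl | rfl <;> simp only [value_one, value_neg_one] <;> omega

theorem hyperoctahedral_ext {n : ℕ} {σ τ : hyperoctahedral n}
    (h : ∀ k, σ.1 (k, 1) = τ.1 (k, 1)) : σ = τ := by
  apply Subtype.ext
  apply Equiv.ext
  rintro ⟨k, ε⟩
  rw [apply_eq, apply_eq τ, h]

theorem mul_apply {n : ℕ} (σ τ : hyperoctahedral n) (p : SignedPoint n) :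
    (σ * τ).1 p = σ.1 (τ.1 p) := rfl

theorem inv_apply_self {n : ℕ} (σ : hyperoctahedral n) (p : SignedPoint n) :
    σ⁻¹.1 (σ.1 p) = p := σ.1.symm_apply_apply p

theorem apply_inv_self {n : ℕ} (σ : hyperoctahedral n) (p : SignedPoint n) :
    σ.1 (σ⁻¹.1 p) = p := σ.1.apply_symm_apply p

theorem fst_apply_ne {n : ℕ} (σ : hyperoctahedral n) {p q : SignedPoint n} (h : p.1 ≠ q.1) :
    (σ.1 p).1 ≠ (σ.1 q).1 := by
  obtain ⟨i, ε⟩ := p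
  obtain ⟨j, δ⟩ := q
  rw [apply_eq, apply_eq σ j δ]
  exact fun e => h ((absPerm σ).injective e)

theorem value_apply_neg {n : ℕ} (σ : hyperoctahedral n) (k : Fin n) (ε : ℤˣ) :
    value (σ.1 (k, -ε)) = -value (σ.1 (k, ε)) := by
  rw [apply_neg, value_neg]

/-- The points `p` and `q` are ordered differently by `σ⁻¹` and by `τ⁻¹`. -/
def Separates {n : ℕ} (σ τ : hyperoctahedral n) (p q : SignedPoint n) : Prop :=
  ¬(value (σ⁻¹.1 p) < value (σ⁻¹.1 q) ↔ value (τ⁻¹.1 p) < value (τ⁻¹.1 q))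

theorem Separates.triangle {n : ℕ} {σ τ ρ : hyperoctahedral n} {p q : SignedPoint n}
    (h : Separates σ ρ p q) : Separates σ τ p q ∨ Separates τ ρ p q := by
  unfold Separates at *
  tauto

theorem separates_symm {n : ℕ} {σ τ : hyperoctahedral n} {p q : SignedPoint n} :
    Separates σ τ p q ↔ Separates τ σ p q := by
  unfold Separates
  tauto

/-- Points with different absolute values keep different absolute values, so no ties occur and
swapping the points negates both comparisons. -/
theorem separates_swap {n : ℕ} {σ τ : hyperoctahedral n} {p q : SignedPoint n} (h : p.1 ≠ q.1) :
    Separates σ τ q p ↔ Separates σ τ p q := by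
  have h1 := value_ne (fst_apply_ne σ⁻¹ h)
  have h2 := value_ne (fst_apply_ne τ⁻¹ h)
  unfold Separates
  have e1 : value (σ⁻¹.1 q) < value (σ⁻¹.1 p) ↔ ¬ value (σ⁻¹.1 p) < value (σ⁻¹.1 q) := by omega
  have e2 : value (τ⁻¹.1 q) < value (τ⁻¹.1 p) ↔ ¬ value (τ⁻¹.1 p) < value (τ⁻¹.1 q) := by omega
  rw [e1, e2]
  tauto

theorem separates_neg {n : ℕ} {σ τ : hyperoctahedral n} {i j : Fin n} {ε δ : ℤˣ} (h : i ≠ j) :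
    Separates σ τ (i, -ε) (j, -δ) ↔ Separates σ τ (i, ε) (j, δ) := by
  rw [← separates_swap (p := (i, ε)) (q := (j, δ)) h]
  unfold Separates
  simp only [value_apply_neg, neg_lt_neg_iff]

theorem separates_mul_left {n : ℕ} {ρ σ τ : hyperoctahedral n} {p q : SignedPoint n} :
    Separates (ρ * σ) (ρ * τ) p q ↔ Separates σ τ (ρ⁻¹.1 p) (ρ⁻¹.1 q) := by
  unfold Separates
  simp only [mul_inv_rev, mul_apply]

open Classical in
/-- The number of the hyperplanes `x_i = 0` that separate the chambers of `σ` and `τ`. -/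
noncomputable def sepOne {n : ℕ} (σ τ : hyperoctahedral n) : ℕ :=
  ∑ i : Fin n, if (σ⁻¹.1 (i, 1)).2 ≠ (τ⁻¹.1 (i, 1)).2 then 1 else 0

open Classical in
/-- The number of the hyperplanes `x_i = ± x_j` that separate the chambers of `σ` and `τ`. -/
noncomputable def sepTwo {n : ℕ} (σ τ : hyperoctahedral n) : ℕ :=
  ∑ i : Fin n, ∑ j : Fin n, ∑ δ : ℤˣ,
    if i < j ∧ Separates σ τ (i, 1) (j, δ) then 1 else 0

theorem sepOne_comm {n : ℕ} (σ τ : hyperoctahedral n) : sepOne σ τ = sepOne τ σ := by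
  simp only [sepOne, ne_comm]

theorem sepTwo_comm {n : ℕ} (σ τ : hyperoctahedral n) : sepTwo σ τ = sepTwo τ σ := by
  classical
  unfold sepTwo
  refine Finset.sum_congr rfl fun i _ => Finset.sum_congr rfl fun j _ =>
    Finset.sum_congr rfl fun δ _ => ?_
  simp only [separates_symm (σ := σ) (τ := τ)]

/-- Signs form a cocycle: the sign of `ρ⁻¹` at `i` is a factor common to both sides and cancels, and
`absPerm ρ⁻¹` permutes the hyperplanes. -/
theorem sepOne_mul_left {n : ℕ} (ρ σ τ : hyperoctahedral n) :
    sepOne (ρ * σ) (ρ * τ) = sepOne σ τ := by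
  classical
  unfold sepOne
  rw [← Equiv.sum_comp (absPerm ρ⁻¹) (fun i => if (σ⁻¹.1 (i, 1)).2 ≠ (τ⁻¹.1 (i, 1)).2 then 1 else 0)]
  refine Finset.sum_congr rfl fun i _ => ?_
  have h : ∀ σ : hyperoctahedral n, ((ρ * σ)⁻¹.1 (i, 1)).2 =
      (ρ⁻¹.1 (i, 1)).2 * (σ⁻¹.1 (absPerm ρ⁻¹ i, 1)).2 := by
    intro σ
    rw [mul_inv_rev, mul_apply]
    exact congrArg Prod.snd (apply_eq σ⁻¹ (ρ⁻¹.1 (i, 1)).1 (ρ⁻¹.1 (i, 1)).2)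
  simp only [h, ne_eq, mul_right_inj]

open Classical in
-- A hyperplane `x_i = ± x_j` is described by the four ordered pairs `(p, q)`, `(q, p)`, `(-p, -q)`,
-- `(-q, -p)`. The sum over all pairs makes no choice of order or sign, so a group element merely
-- permutes its terms; `sepTwo_mul_left` rests on this.
theorem four_mul_sepTwo {n : ℕ} (σ τ : hyperoctahedral n) :
    4 * sepTwo σ τ = ∑ p : SignedPoint n, ∑ q : SignedPoint n,
      if p.1 ≠ q.1 ∧ Separates σ τ p q then 1 else 0 := by
  set G : Fin n → Fin n → ℕ := fun i j =>
    ∑ δ : ℤˣ, if i ≠ j ∧ Separates σ τ (i, 1) (j, δ) then 1 else 0 with hG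
  have hU : ∀ f : ℤˣ → ℕ, ∑ ε, f ε = f 1 + f (-1) := by
    intro f
    have : (Finset.univ : Finset ℤˣ) = {1, -1} := rfl
    rw [this, Finset.sum_pair (by decide)]
  have hs : ∀ i j, G i j = G j i := by
    intro i j
    by_cases h : i = j
    · rw [h]
    · simp only [hG, hU]
      congr 1
      · simp only [separates_swap (p := (i, (1 : ℤˣ))) (q := (j, (1 : ℤˣ))) h, ne_comm]
      · have := separates_neg (σ := σ) (τ := τ) (ε := -1) (δ := 1) h
        rw [neg_neg] at this
        rw [this, ← separates_swap (p := (i, (-1 : ℤˣ))) (q := (j, (1 : ℤˣ))) h]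
        simp only [ne_comm]
  have h1 : sepTwo σ τ = ∑ i, ∑ j, if i < j then G i j else 0 := by
    unfold sepTwo
    refine Finset.sum_congr rfl fun i _ => Finset.sum_congr rfl fun j _ => ?_
    split_ifs with h
    · simp only [h, h.ne, ne_eq, not_false_eq_true, true_and, hG]
    · simp [h]
  have h2 : ∑ i, ∑ j, G i j = 2 * sepTwo σ τ := by
    have : ∑ i, ∑ j, G i j = ∑ i, ∑ j, ((if i < j then G i j else 0) +
        (if j < i then G j i else 0)) := by
      refine Finset.sum_congr rfl fun i _ => Finset.sum_congr rfl fun j _ => ?_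
      rcases lt_trichotomy i j with h | h | h
      · simp [h, h.not_gt]
      · subst h; simp [hG]
      · simp [h, h.not_gt, hs i j]
    rw [this]
    simp only [Finset.sum_add_distrib]
    rw [Finset.sum_comm (f := fun i j => if j < i then G j i else 0), ← h1]
    ring
  -- Negating both points matches the pairs that start at `-i` with those that start at `i`.
  have h3 : ∀ i : Fin n, ∑ q : SignedPoint n, (if i ≠ q.1 ∧ Separates σ τ (i, -1) q then 1 else 0)
      = ∑ q : SignedPoint n, (if i ≠ q.1 ∧ Separates σ τ (i, 1) q then 1 else 0) := by
    intro i
    simp only [Fintype.sum_prod_type]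
    refine Finset.sum_congr rfl fun j _ => ?_
    by_cases h : i = j
    · simp [h]
    · rw [← Equiv.sum_comp (Equiv.neg ℤˣ)]
      simp only [Equiv.neg_apply, separates_neg h]
  have h4 : (4 : ℕ) = 2 * 2 := rfl
  rw [h4, mul_assoc, ← h2, Fintype.sum_prod_type]
  simp only [hU, h3]
  simp only [Fintype.sum_prod_type, hG, ← two_mul, Finset.mul_sum]

theorem sepTwo_mul_left {n : ℕ} (ρ σ τ : hyperoctahedral n) :
    sepTwo (ρ * σ) (ρ * τ) = sepTwo σ τ := by
  classical
  refine Nat.eq_of_mul_eq_mul_left (by norm_num : 0 < 4) ?_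
  rw [four_mul_sepTwo, four_mul_sepTwo, ← Equiv.sum_comp ρ.1]
  refine Finset.sum_congr rfl fun p _ => ?_
  rw [← Equiv.sum_comp ρ.1]
  refine Finset.sum_congr rfl fun q _ => ?_
  rw [separates_mul_left, inv_apply_self, inv_apply_self]
  have : (ρ.1 p).1 ≠ (ρ.1 q).1 ↔ p.1 ≠ q.1 := by
    refine ⟨fun h => ?_, fst_apply_ne ρ⟩
    have := fst_apply_ne ρ⁻¹ h
    rwa [inv_apply_self, inv_apply_self] at this
  simp only [this]

theorem sepOne_triangle {n : ℕ} (σ τ ρ : hyperoctahedral n) :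
    sepOne σ ρ ≤ sepOne σ τ + sepOne τ ρ := by
  classical
  unfold sepOne
  rw [← Finset.sum_add_distrib]
  refine Finset.sum_le_sum fun i _ => ?_
  split_ifs <;> simp_all

theorem sepTwo_triangle {n : ℕ} (σ τ ρ : hyperoctahedral n) :
    sepTwo σ ρ ≤ sepTwo σ τ + sepTwo τ ρ := by
  classical
  unfold sepTwo
  simp only [← Finset.sum_add_distrib]
  refine Finset.sum_le_sum fun i _ => Finset.sum_le_sum fun j _ => Finset.sum_le_sum fun δ _ => ?_
  by_cases h : i < j ∧ Separates σ ρ (i, 1) (j, δ)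
  · rcases h.2.triangle (τ := τ) with h' | h' <;> simp [h, h']
  · simp [h]

theorem sepOne_self {n : ℕ} (σ : hyperoctahedral n) : sepOne σ σ = 0 := by
  simp [sepOne]

theorem sepTwo_self {n : ℕ} (σ : hyperoctahedral n) : sepTwo σ σ = 0 := by
  simp [sepTwo, Separates]

/-- Pass from `1` to `σ τ` through `σ`; left-invariance moves the second leg back to `1`. -/
theorem sepOne_mul_le {n : ℕ} (σ τ : hyperoctahedral n) :
    sepOne 1 (σ * τ) ≤ sepOne 1 σ + sepOne 1 τ := by
  have h := sepOne_triangle 1 σ (σ * τ)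
  have e := sepOne_mul_left σ 1 τ
  rw [mul_one] at e
  rwa [e] at h

theorem sepTwo_mul_le {n : ℕ} (σ τ : hyperoctahedral n) :
    sepTwo 1 (σ * τ) ≤ sepTwo 1 σ + sepTwo 1 τ := by
  have h := sepTwo_triangle 1 σ (σ * τ)
  have e := sepTwo_mul_left σ 1 τ
  rw [mul_one] at e
  rwa [e] at h

/-! ## Generators -/

theorem gen_inv {n : ℕ} (i : Fin n) : (gen i)⁻¹ = gen i := by
  unfold gen
  split_ifs
  · apply Subtype.ext
    simp [signFlip]
  · rw [← map_inv, Equiv.swap_inv]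

theorem gen_apply_of_eq_zero {n : ℕ} {i : Fin n} (hi : i.val = 0) (k : Fin n) :
    (gen i).1 (k, 1) = (k, if k = i then -1 else 1) := by
  simp only [gen, hi, if_true, signFlip]
  split_ifs with h
  · subst h
    exact Equiv.swap_apply_left _ _
  · rw [Equiv.swap_apply_of_ne_of_ne] <;> simp [h]

theorem gen_apply_of_ne_zero {n : ℕ} {i : Fin n} (hi : i.val ≠ 0) (k : Fin n) (ε : ℤˣ) :
    (gen i).1 (k, ε) =
      (Equiv.swap ⟨i.val - 1, lt_of_le_of_lt (Nat.sub_le _ _) i.isLt⟩ i k, ε) := by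
  rw [gen, if_neg hi, ofPerm_apply]

theorem one_apply {n : ℕ} (p : SignedPoint n) : (1 : hyperoctahedral n).1 p = p := rfl

theorem sepOne_gen_le {n : ℕ} (i : Fin n) :
    sepOne 1 (gen i) ≤ if i.val = 0 then 1 else 0 := by
  classical
  unfold sepOne
  rw [gen_inv, inv_one]
  split_ifs with hi
  · have : (1 : ℕ) = ∑ k : Fin n, if k = i then 1 else 0 := by simp
    rw [this]
    refine Finset.sum_le_sum fun k _ => ?_
    rw [gen_apply_of_eq_zero hi, one_apply]
    split_ifs <;> simp_all
  · simp [gen_apply_of_ne_zero hi]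

theorem val_swap {n : ℕ} (a b k : Fin n) :
    (Equiv.swap a b k).val = if k.val = a.val then b.val else if k.val = b.val then a.val else k.val := by
  simp only [Equiv.swap_apply_def, ← Fin.val_inj]
  split_ifs <;> rfl

/-- A simple reflection crosses only its own wall: none of this kind for `π_0`, and `x_{i-1} = x_i`
(in `Fin n`) otherwise. -/
theorem sepTwo_gen_le {n : ℕ} (i : Fin n) :
    sepTwo 1 (gen i) ≤ if i.val = 0 then 0 else 1 := by
  classical
  unfold sepTwo Separates
  rw [gen_inv, inv_one]
  split_ifs with hi
  · refine (Finset.sum_eq_zero fun a _ => Finset.sum_eq_zero fun b _ =>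
      Finset.sum_eq_zero fun δ _ => if_neg ?_).le
    rintro ⟨hab, h⟩
    apply h
    have hb : b ≠ i := by
      rintro rfl
      exact absurd hab (by rw [Fin.lt_def]; omega)
    have hb' : (gen i).1 (b, δ) = (b, δ) := by
      rw [apply_eq, gen_apply_of_eq_zero hi]; simp [hb]
    rw [hb', gen_apply_of_eq_zero hi, one_apply, one_apply]
    rw [Fin.lt_def] at hab
    split_ifs <;> rcases Int.units_eq_one_or δ with rfl | rfl <;>
      simp only [value_one, value_neg_one] <;> omega
  -- The bound `1` is written as the indicator of that wall, so that the sums compare term by term.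
  · have : (1 : ℕ) = ∑ a : Fin n, ∑ b : Fin n, ∑ δ : ℤˣ,
        if a = ⟨i.val - 1, lt_of_le_of_lt (Nat.sub_le _ _) i.isLt⟩ then
          if b = i then if δ = 1 then 1 else 0 else 0 else 0 := by
      simp
    conv_rhs => rw [this]
    refine Finset.sum_le_sum fun a _ => Finset.sum_le_sum fun b _ =>
      Finset.sum_le_sum fun δ _ => ?_
    by_cases hc : a.val = i.val - 1 ∧ b.val = i.val ∧ δ = 1
    · rw [if_pos (Fin.ext hc.1), if_pos (Fin.ext hc.2.1), if_pos hc.2.2]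
      split_ifs <;> simp
    · rw [if_neg]
      · exact Nat.zero_le _
      rintro ⟨hab, h⟩
      apply h
      simp only [gen_apply_of_ne_zero hi, one_apply]
      rw [Fin.lt_def] at hab
      rcases Int.units_eq_one_or δ with rfl | rfl
      · simp only [value_one, val_swap]
        simp only [and_true] at hc
        split_ifs <;> omega
      · simp only [value_one, value_neg_one]
        omega

theorem sepOne_prod_le {n : ℕ} (w : List (Fin n)) :
    sepOne 1 (w.map gen).prod ≤ w.countP fun i => i.val = 0 := by
  induction w with
  | nil => simp [sepOne_self]
  | cons i w ih =>
    rw [List.map_cons, List.prod_cons, List.countP_cons]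
    have := sepOne_mul_le (gen i) (w.map gen).prod
    have := sepOne_gen_le i
    simp only [decide_eq_true_eq]
    omega

theorem sepTwo_prod_le {n : ℕ} (w : List (Fin n)) :
    sepTwo 1 (w.map gen).prod ≤ w.countP fun i => i.val ≠ 0 := by
  induction w with
  | nil => simp [sepTwo_self]
  | cons i w ih =>
    rw [List.map_cons, List.prod_cons, List.countP_cons]
    have := sepTwo_mul_le (gen i) (w.map gen).prod
    have := sepTwo_gen_le i
    simp only [ne_eq] at ih
    by_cases hi : i.val = 0
    · rw [if_pos hi] at this
      simp only [hi, ne_eq, not_true_eq_false, decide_false, Bool.false_eq_true, if_false]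
      omega
    · rw [if_neg hi] at this
      simp only [hi, ne_eq, not_false_eq_true, decide_true, if_true]
      omega

/-! ## Decomposition of `Σ(n + 1)` into cosets of `Σ(n)` -/

/-- The element of `Σ(n)` with prescribed values at the positive points. -/
noncomputable def ofInjective {n : ℕ} (f : Fin n → SignedPoint n)
    (hf : Function.Injective fun k => (f k).1) : hyperoctahedral n :=
  ⟨Equiv.ofBijective (fun p : SignedPoint n => ((f p.1).1, p.2 * (f p.1).2)) (by
      rw [← Finite.injective_iff_bijective]
      rintro ⟨i, ε⟩ ⟨j, δ⟩ h
      obtain ⟨h1, h2⟩ := Prod.mk.inj h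
      obtain rfl : i = j := hf h1
      rw [mul_left_inj] at h2
      exact Prod.ext rfl h2), by
    intro k ε
    simp⟩

theorem ofInjective_apply {n : ℕ} (f : Fin n → SignedPoint n)
    (hf : Function.Injective fun k => (f k).1) (k : Fin n) (ε : ℤˣ) :
    (ofInjective f hf).1 (k, ε) = ((f k).1, ε * (f k).2) := rfl

theorem ofInjective_apply_one {n : ℕ} (f : Fin n → SignedPoint n)
    (hf : Function.Injective fun k => (f k).1) (k : Fin n) :
    (ofInjective f hf).1 (k, 1) = f k := by
  rw [ofInjective_apply, one_mul]

theorem extend_values_injective {n : ℕ} (τ : hyperoctahedral n) :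
    Function.Injective fun k => (Fin.snoc (α := fun _ => SignedPoint (n + 1))
      (fun k => ((τ.1 (k, 1)).1.castSucc, (τ.1 (k, 1)).2)) (Fin.last n, 1) k).1 := by
  intro i j
  refine Fin.lastCases ?_ (fun i => ?_) i <;> refine Fin.lastCases ?_ (fun j => ?_) j
  · simp
  · simp [(Fin.castSucc_ne_last _).symm]
  · simp
  · simp only [Fin.snoc_castSucc, Fin.castSucc_inj]
    exact fun h => (absPerm τ).injective h

/-- The inclusion of `Σ(n)` in `Σ(n + 1)` as the stabilizer of the last point. -/
noncomputable def extend {n : ℕ} (τ : hyperoctahedral n) : hyperoctahedral (n + 1) :=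
  ofInjective _ (extend_values_injective τ)

theorem extend_castSucc {n : ℕ} (τ : hyperoctahedral n) (k : Fin n) (ε : ℤˣ) :
    (extend τ).1 (k.castSucc, ε) = ((τ.1 (k, ε)).1.castSucc, (τ.1 (k, ε)).2) := by
  rw [extend, ofInjective_apply, Fin.snoc_castSucc, apply_eq τ k ε]

theorem extend_last {n : ℕ} (τ : hyperoctahedral n) (ε : ℤˣ) :
    (extend τ).1 (Fin.last n, ε) = (Fin.last n, ε) := by
  rw [extend, ofInjective_apply, Fin.snoc_last, mul_one]

theorem extend_one {n : ℕ} : extend (1 : hyperoctahedral n) = 1 := by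
  refine hyperoctahedral_ext fun k => ?_
  refine Fin.lastCases ?_ (fun i => ?_) k
  · rw [extend_last, one_apply]
  · rw [extend_castSucc, one_apply, one_apply]

theorem extend_mul {n : ℕ} (σ τ : hyperoctahedral n) : extend (σ * τ) = extend σ * extend τ := by
  refine hyperoctahedral_ext fun k => ?_
  refine Fin.lastCases ?_ (fun i => ?_) k
  · simp only [mul_apply, extend_last]
  · simp only [mul_apply, extend_castSucc]

theorem extend_inv {n : ℕ} (τ : hyperoctahedral n) : extend τ⁻¹ = (extend τ)⁻¹ := by
  rw [eq_inv_iff_mul_eq_one, ← extend_mul, inv_mul_cancel, extend_one]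

theorem extend_injective {n : ℕ} : Function.Injective (extend (n := n)) := by
  intro σ τ h
  refine hyperoctahedral_ext fun k => ?_
  have := congrArg (fun ρ : hyperoctahedral (n + 1) => ρ.1 (k.castSucc, 1)) h
  simp only [extend_castSucc, Prod.mk.injEq, Fin.castSucc_inj] at this
  exact Prod.ext this.1 this.2

theorem cosetRep_values_injective {n : ℕ} (k : Fin (n + 1)) (ε : ℤˣ) :
    Function.Injective fun i => (Fin.snoc (α := fun _ => SignedPoint (n + 1))
      (fun i => (k.succAbove i, 1)) (k, ε) i).1 := by
  intro i j
  refine Fin.lastCases ?_ (fun i => ?_) i <;> refine Fin.lastCases ?_ (fun j => ?_) j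
  · simp
  · simp [(Fin.succAbove_ne _ _).symm]
  · simp
  · simp

/-- The element of `Σ(n + 1)` that maps `ε (k + 1)` to the last point, and maps the remaining
positive points increasingly to `1, …, n`. -/
noncomputable def cosetRep {n : ℕ} (k : Fin (n + 1)) (ε : ℤˣ) : hyperoctahedral (n + 1) :=
  (ofInjective _ (cosetRep_values_injective k ε))⁻¹

theorem cosetRep_inv_castSucc {n : ℕ} (k : Fin (n + 1)) (ε : ℤˣ) (i : Fin n) (δ : ℤˣ) :
    (cosetRep k ε)⁻¹.1 (i.castSucc, δ) = (k.succAbove i, δ) := by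
  rw [cosetRep, inv_inv, ofInjective_apply, Fin.snoc_castSucc, mul_one]

theorem cosetRep_inv_last {n : ℕ} (k : Fin (n + 1)) (ε δ : ℤˣ) :
    (cosetRep k ε)⁻¹.1 (Fin.last n, δ) = (k, δ * ε) := by
  rw [cosetRep, inv_inv, ofInjective_apply, Fin.snoc_last]

theorem exists_extend_eq {n : ℕ} (ρ : hyperoctahedral (n + 1))
    (h : ρ.1 (Fin.last n, 1) = (Fin.last n, 1)) : ∃ τ, extend τ = ρ := by
  have hne : ∀ k : Fin n, (ρ.1 (k.castSucc, 1)).1 ≠ Fin.last n := by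
    intro k e
    have := fst_apply_ne ρ (p := (k.castSucc, 1)) (q := (Fin.last n, 1)) (Fin.castSucc_ne_last k)
    rw [h] at this
    exact this e
  have hinj : Function.Injective fun k => ((ρ.1 (k.castSucc, 1)).1.castPred (hne k)) := by
    intro i j hij
    simp only [Fin.castPred_inj] at hij
    exact Fin.castSucc_injective n ((absPerm ρ).injective hij)
  refine ⟨ofInjective (fun k => ((ρ.1 (k.castSucc, 1)).1.castPred (hne k),
    (ρ.1 (k.castSucc, 1)).2)) hinj, hyperoctahedral_ext fun k => ?_⟩
  refine Fin.lastCases ?_ (fun i => ?_) k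
  · rw [extend_last, h]
  · rw [extend_castSucc, ofInjective_apply_one, Fin.castSucc_castPred]

/-- The inverse of the product sends the last point to `(k, ε)`, since `extend τ` fixes it; this
recovers `k` and `ε`. Dividing an arbitrary `σ` by that representative leaves an element fixing the
last point. -/
theorem extend_mul_cosetRep_bijective {n : ℕ} :
    Function.Bijective fun t : hyperoctahedral n × Fin (n + 1) × ℤˣ =>
      extend t.1 * cosetRep t.2.1 t.2.2 := by
  have hlast : ∀ (τ : hyperoctahedral n) (k : Fin (n + 1)) (ε : ℤˣ),
      (extend τ * cosetRep k ε)⁻¹.1 (Fin.last n, 1) = (k, ε) := by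
    intro τ k ε
    rw [mul_inv_rev, mul_apply, ← extend_inv, extend_last, cosetRep_inv_last, one_mul]
  constructor
  · rintro ⟨σ, k, ε⟩ ⟨τ, l, δ⟩ h
    have h' := congrArg (fun ρ : hyperoctahedral (n + 1) => ρ⁻¹.1 (Fin.last n, 1)) h
    simp only [hlast, Prod.mk.injEq] at h'
    obtain ⟨rfl, rfl⟩ := h'
    exact Prod.ext (extend_injective (mul_right_cancel h)) rfl
  · intro σ
    obtain ⟨τ, hτ⟩ := exists_extend_eq
      (σ * (cosetRep (σ⁻¹.1 (Fin.last n, 1)).1 (σ⁻¹.1 (Fin.last n, 1)).2)⁻¹) (by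
        rw [mul_apply, cosetRep_inv_last, one_mul, Prod.mk.eta, apply_inv_self])
    refine ⟨(τ, (σ⁻¹.1 (Fin.last n, 1)).1, (σ⁻¹.1 (Fin.last n, 1)).2), ?_⟩
    change extend τ * cosetRep _ _ = σ
    rw [hτ, inv_mul_cancel_right]

/-! ### Hyperplane counts of the coset products -/

theorem value_castSucc {n : ℕ} (p : SignedPoint n) :
    value ((p.1.castSucc, p.2) : SignedPoint (n + 1)) = value p := rfl

theorem value_succAbove_lt_iff {n : ℕ} (k : Fin (n + 1)) (p q : SignedPoint n) :
    value ((k.succAbove p.1, p.2) : SignedPoint (n + 1)) < value (k.succAbove q.1, q.2) ↔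
      value p < value q := by
  obtain ⟨i, ε⟩ := p
  obtain ⟨j, δ⟩ := q
  have h : (k.succAbove i).val < (k.succAbove j).val ↔ i.val < j.val := by
    rw [Fin.val_fin_lt, Fin.succAbove_lt_succAbove_iff, Fin.lt_def]
  have h' : (k.succAbove j).val < (k.succAbove i).val ↔ j.val < i.val := by
    rw [Fin.val_fin_lt, Fin.succAbove_lt_succAbove_iff, Fin.lt_def]
  rcases Int.units_eq_one_or ε with rfl | rfl <;>
    rcases Int.units_eq_one_or δ with rfl | rfl <;> simp only [value_one, value_neg_one] <;> omega

theorem sepOne_one_left {n : ℕ} (σ : hyperoctahedral n) : sepOne 1 σ⁻¹ = sepOne 1 σ := by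
  have := sepOne_mul_left σ 1 σ⁻¹
  rw [← this, mul_one, mul_inv_cancel, sepOne_comm]

theorem sepTwo_one_left {n : ℕ} (σ : hyperoctahedral n) : sepTwo 1 σ⁻¹ = sepTwo 1 σ := by
  have := sepTwo_mul_left σ 1 σ⁻¹
  rw [← this, mul_one, mul_inv_cancel, sepTwo_comm]

/-- After translation the chambers of `extend τ⁻¹` and `cosetRep k ε` are compared. On the first `n`
points the inverse representative keeps signs, as `1` does; the last hyperplane separates exactly
when `ε = -1`. -/
theorem sepOne_extend_mul {n : ℕ} (τ : hyperoctahedral n) (k : Fin (n + 1)) (ε : ℤˣ) :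
    sepOne 1 (extend τ * cosetRep k ε) = sepOne 1 τ + if ε = 1 then 0 else 1 := by
  classical
  have h := sepOne_mul_left (extend τ) (extend τ⁻¹) (cosetRep k ε)
  rw [extend_inv, mul_inv_cancel, ← extend_inv] at h
  rw [h, ← sepOne_one_left τ, sepOne_comm 1]
  unfold sepOne
  rw [Fin.sum_univ_castSucc, ← extend_inv]
  congr 1
  · refine Finset.sum_congr rfl fun i _ => ?_
    rw [extend_castSucc, cosetRep_inv_castSucc, inv_one, one_apply]
  · rw [extend_last, cosetRep_inv_last, one_mul]
    by_cases hε : ε = 1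
    · simp [hε]
    · simp [hε, Ne.symm hε]

theorem sum_units {M : Type*} [AddCommMonoid M] (f : ℤˣ → M) : ∑ ε, f ε = f 1 + f (-1) := by
  have : (Finset.univ : Finset ℤˣ) = {1, -1} := rfl
  rw [this, Finset.sum_pair (by decide)]

theorem sum_ite_succAbove_lt {n : ℕ} (k : Fin (n + 1)) :
    (∑ i : Fin n, if (k.succAbove i).val < k.val then 1 else 0) = k.val := by
  have h : ∀ i : Fin n, (k.succAbove i).val < k.val ↔ i.val < k.val := by
    intro i
    rw [Fin.val_fin_lt, Fin.succAbove_lt_iff_castSucc_lt, Fin.lt_def]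
    rfl
  simp only [h]
  rw [Fin.sum_univ_eq_sum_range (fun i => if i < k.val then 1 else 0) n,
    ← Finset.card_filter]
  have : (Finset.range n).filter (fun i => i < k.val) = Finset.range k.val := by
    ext i
    have := k.isLt
    simp only [Finset.mem_filter, Finset.mem_range]
    omega
  rw [this, Finset.card_range]

theorem sum_ite_lt_succAbove {n : ℕ} (k : Fin (n + 1)) :
    (∑ i : Fin n, if k.val < (k.succAbove i).val then 1 else 0) = n - k.val := by
  have h : (∑ i : Fin n, if (k.succAbove i).val < k.val then 1 else 0) +
      (∑ i : Fin n, if k.val < (k.succAbove i).val then 1 else 0) = n := by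
    rw [← Finset.sum_add_distrib]
    have : ∀ i : Fin n, ((if (k.succAbove i).val < k.val then 1 else 0) +
        (if k.val < (k.succAbove i).val then 1 else 0) : ℕ) = 1 := by
      intro i
      have : (k.succAbove i).val ≠ k.val := fun e => Fin.succAbove_ne k i (Fin.ext e)
      split_ifs <;> omega
    rw [Finset.sum_congr rfl fun i _ => this i]
    simp
  rw [sum_ite_succAbove_lt] at h
  omega

/-- After the same translation, hyperplanes among the first `n` coordinates see the inverse
representative as order preserving, hence as `1`, and give `sepTwo 1 τ`. Those that involve the last
coordinate give the rest: for `ε = 1` one for each index above `k`; for `ε = -1` all `n` with `δ =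
1`, and one with `δ = -1` for each index below `k`. -/
theorem sepTwo_extend_mul {n : ℕ} (τ : hyperoctahedral n) (k : Fin (n + 1)) (ε : ℤˣ) :
    sepTwo 1 (extend τ * cosetRep k ε) =
      sepTwo 1 τ + if ε = 1 then n - k.val else n + k.val := by
  classical
  have h := sepTwo_mul_left (extend τ) (extend τ⁻¹) (cosetRep k ε)
  rw [extend_inv, mul_inv_cancel, ← extend_inv] at h
  rw [h, ← sepTwo_one_left τ, sepTwo_comm 1]
  unfold sepTwo
  rw [Fin.sum_univ_castSucc]
  have h0 : (∑ j : Fin (n + 1), ∑ δ : ℤˣ, if Fin.last n < j ∧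
      Separates (extend τ⁻¹) (cosetRep k ε) (Fin.last n, 1) (j, δ) then 1 else 0) = 0 := by
    refine Finset.sum_eq_zero fun j _ => Finset.sum_eq_zero fun δ _ => if_neg ?_
    exact fun h => absurd h.1 (Fin.le_last j).not_gt
  rw [h0, add_zero]
  simp only [Fin.sum_univ_castSucc]
  rw [Finset.sum_add_distrib]
  congr 1
  · refine Finset.sum_congr rfl fun i _ => Finset.sum_congr rfl fun j _ =>
      Finset.sum_congr rfl fun δ _ => ?_
    have : Separates (extend τ⁻¹) (cosetRep k ε) (i.castSucc, 1) (j.castSucc, δ) ↔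
        Separates τ⁻¹ 1 (i, 1) (j, δ) := by
      unfold Separates
      rw [← extend_inv, extend_castSucc, extend_castSucc, cosetRep_inv_castSucc,
        cosetRep_inv_castSucc, value_castSucc, value_castSucc, inv_one, one_apply, one_apply,
        value_succAbove_lt_iff k (i, 1) (j, δ)]
    simp only [this, Fin.castSucc_lt_castSucc_iff]
  · have hs : ∀ (i : Fin n) (δ : ℤˣ),
        Separates (extend τ⁻¹) (cosetRep k ε) (i.castSucc, 1) (Fin.last n, δ) ↔
          ¬ (δ = 1 ↔ value ((k.succAbove i, 1) : SignedPoint (n + 1)) < value (k, δ * ε)) := by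
      intro i δ
      unfold Separates
      rw [← extend_inv, extend_castSucc, extend_last, cosetRep_inv_castSucc, cosetRep_inv_last]
      -- The last point has the largest absolute value, so its sign alone decides the comparison.
      have : value (((τ⁻¹⁻¹.1 (i, 1)).1.castSucc, (τ⁻¹⁻¹.1 (i, 1)).2) : SignedPoint (n + 1)) <
          value (Fin.last n, δ) ↔ δ = 1 := by
        generalize τ⁻¹⁻¹.1 (i, 1) = p
        obtain ⟨j, η⟩ := p
        have := j.isLt
        rcases Int.units_eq_one_or η with rfl | rfl <;>
          rcases Int.units_eq_one_or δ with rfl | rfl <;>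
          simp only [value_one, value_neg_one, Fin.val_last, Fin.val_castSucc] <;> simp <;> omega
      rw [this]
    simp only [hs, Fin.castSucc_lt_last, true_and, sum_units, Finset.sum_add_distrib]
    have hne : ∀ i : Fin n, (k.succAbove i).val ≠ k.val :=
      fun i e => Fin.succAbove_ne k i (Fin.ext e)
    have hu : (-1 : ℤˣ) ≠ 1 := by decide
    rcases Int.units_eq_one_or ε with rfl | rfl
    · have e1 : ∀ i : Fin n, ¬ (True ↔
          value ((k.succAbove i, 1) : SignedPoint (n + 1)) < value (k, 1 * 1)) ↔
          k.val < (k.succAbove i).val := by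
        intro i
        have := hne i
        simp only [mul_one, value_one, true_iff]
        omega
      have e2 : ∀ i : Fin n, ¬ (((-1 : ℤˣ) = 1) ↔
          value ((k.succAbove i, 1) : SignedPoint (n + 1)) < value (k, -1 * 1)) ↔ False := by
        intro i
        simp only [mul_one, value_one, value_neg_one, hu, false_iff, not_not]
        simp only [iff_false]
        omega
      simp only [e1, e2]
      rw [sum_ite_lt_succAbove]
      simp
    · have e1 : ∀ i : Fin n, ¬ (True ↔
          value ((k.succAbove i, 1) : SignedPoint (n + 1)) < value (k, 1 * -1)) ↔ True := by
        intro i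
        simp only [one_mul, value_one, value_neg_one, true_iff, iff_true]
        omega
      have e2 : ∀ i : Fin n, ¬ (((-1 : ℤˣ) = 1) ↔
          value ((k.succAbove i, 1) : SignedPoint (n + 1)) < value (k, -1 * -1)) ↔
          (k.succAbove i).val < k.val := by
        intro i
        rw [neg_mul_neg, one_mul]
        simp only [value_one, hu, false_iff, not_not]
        omega
      simp only [e1, e2]
      rw [sum_ite_succAbove_lt]
      simp [hu]

/-! ## Lengths -/

theorem extend_gen {n : ℕ} (i : Fin n) : extend (gen i) = gen i.castSucc := by
  refine hyperoctahedral_ext fun k => ?_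
  by_cases hi : i.val = 0
  · have hi' : i.castSucc.val = 0 := hi
    rw [gen_apply_of_eq_zero hi']
    refine Fin.lastCases ?_ (fun j => ?_) k
    · rw [extend_last, if_neg (Fin.castSucc_ne_last i).symm]
    · rw [extend_castSucc, gen_apply_of_eq_zero hi]
      simp
  · have hi' : i.castSucc.val ≠ 0 := hi
    rw [gen_apply_of_ne_zero hi']
    refine Prod.ext (Fin.ext ?_) ?_
    · refine Fin.lastCases ?_ (fun j => ?_) k
      · rw [extend_last, val_swap]
        have := i.isLt
        simp only [Fin.val_last, Fin.val_castSucc]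
        split_ifs <;> omega
      · rw [extend_castSucc, gen_apply_of_ne_zero hi, val_swap, Fin.val_castSucc, val_swap]
        rfl
    · refine Fin.lastCases ?_ (fun j => ?_) k
      · rw [extend_last]
      · rw [extend_castSucc, gen_apply_of_ne_zero hi]

/-- One edge of the coset graph, which is a path: from the last point down to the first, across the
sign change, and back up through the negative points. -/
theorem cosetRep_eq_mul_gen {n : ℕ} {k l : Fin (n + 1)} {ε δ : ℤˣ} (i : Fin (n + 1))
    (h : ∀ j, (gen i).1 (k.succAbove j, 1) = (l.succAbove j, 1))
    (h' : (gen i).1 (k, ε) = (l, δ)) : cosetRep l δ = cosetRep k ε * gen i := by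
  rw [← inv_inj]
  refine hyperoctahedral_ext fun j => ?_
  rw [mul_inv_rev, gen_inv, mul_apply]
  refine Fin.lastCases ?_ (fun j => ?_) j
  · rw [cosetRep_inv_last, cosetRep_inv_last, one_mul, one_mul, h']
  · rw [cosetRep_inv_castSucc, cosetRep_inv_castSucc, h]

theorem val_succAbove {n : ℕ} (k : Fin (n + 1)) (i : Fin n) :
    (k.succAbove i).val = if i.val < k.val then i.val else i.val + 1 := by
  rw [Fin.succAbove]
  simp only [Fin.lt_def, Fin.val_castSucc]
  split_ifs <;> rfl

theorem cosetRep_castSucc_one {n : ℕ} (k : Fin n) :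
    cosetRep k.castSucc 1 = cosetRep k.succ 1 * gen k.succ := by
  have hk : k.succ.val ≠ 0 := by simp
  refine cosetRep_eq_mul_gen _ (fun j => ?_) ?_
  · rw [gen_apply_of_ne_zero hk]
    refine Prod.ext (Fin.ext ?_) rfl
    simp only [val_swap, val_succAbove, Fin.val_succ, Fin.val_castSucc]
    split_ifs <;> omega
  · rw [gen_apply_of_ne_zero hk, Equiv.swap_apply_right]
    rfl

theorem cosetRep_zero_neg {n : ℕ} :
    cosetRep (0 : Fin (n + 1)) (-1) = cosetRep 0 1 * gen 0 := by
  refine cosetRep_eq_mul_gen _ (fun j => ?_) ?_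
  · rw [gen_apply_of_eq_zero rfl, if_neg (Fin.succAbove_ne _ _)]
  · rw [gen_apply_of_eq_zero rfl, if_pos rfl]

theorem cosetRep_succ_neg {n : ℕ} (k : Fin n) :
    cosetRep k.succ (-1) = cosetRep k.castSucc (-1) * gen k.succ := by
  have hk : k.succ.val ≠ 0 := by simp
  refine cosetRep_eq_mul_gen _ (fun j => ?_) ?_
  · rw [gen_apply_of_ne_zero hk]
    refine Prod.ext (Fin.ext ?_) rfl
    simp only [val_swap, val_succAbove, Fin.val_succ, Fin.val_castSucc]
    split_ifs <;> omega
  · rw [gen_apply_of_ne_zero hk]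
    refine Prod.ext (Fin.ext ?_) rfl
    simp only [val_swap, Fin.val_succ, Fin.val_castSucc]
    split_ifs <;> omega

theorem cosetRep_last_one {n : ℕ} : cosetRep (Fin.last n) 1 = 1 := by
  rw [← inv_inj]
  refine hyperoctahedral_ext fun j => ?_
  rw [inv_one, one_apply]
  refine Fin.lastCases ?_ (fun j => ?_) j
  · rw [cosetRep_inv_last, one_mul]
  · rw [cosetRep_inv_castSucc, Fin.succAbove_last]

theorem exists_word_mul_gen {n : ℕ} {σ : hyperoctahedral n} {m : ℕ}
    (h : ∃ w : List (Fin n), (w.map gen).prod = σ ∧ w.length = m) (i : Fin n) :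
    ∃ w : List (Fin n), (w.map gen).prod = σ * gen i ∧ w.length = m + 1 := by
  obtain ⟨w, hw, hm⟩ := h
  exact ⟨w ++ [i], by simp [hw], by simp [hm]⟩

/-- Walk along this path: `n - k` steps reach `k`; reaching `-k` takes `n` steps down, one sign
change and `k` steps up. -/
theorem exists_word_cosetRep {n : ℕ} (k : Fin (n + 1)) (ε : ℤˣ) :
    ∃ w : List (Fin (n + 1)), (w.map gen).prod = cosetRep k ε ∧
      w.length = if ε = 1 then n - k.val else n + k.val + 1 := by
  have hpos : ∀ k : Fin (n + 1), ∃ w : List (Fin (n + 1)),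
      (w.map gen).prod = cosetRep k 1 ∧ w.length = n - k.val := by
    intro k
    induction k using Fin.reverseInduction with
    | last => exact ⟨[], by simp [cosetRep_last_one], by simp⟩
    | cast i ih =>
      rw [cosetRep_castSucc_one]
      obtain ⟨w, hw, hl⟩ := exists_word_mul_gen ih i.succ
      refine ⟨w, hw, ?_⟩
      have := i.isLt
      simp only [Fin.val_succ, Fin.val_castSucc] at *
      omega
  rcases Int.units_eq_one_or ε with rfl | rfl
  · simpa using hpos k
  · rw [if_neg (by decide)]
    induction k using Fin.induction with
    | zero =>
      rw [cosetRep_zero_neg]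
      exact exists_word_mul_gen (hpos 0) 0
    | succ i ih =>
      rw [cosetRep_succ_neg]
      exact exists_word_mul_gen ih i.succ

/-- Induction over the coset decomposition: the word for the representative is exactly as long as
the hyperplane counts grow. -/
theorem exists_word_length_le {n : ℕ} (σ : hyperoctahedral n) :
    ∃ w : List (Fin n), (w.map gen).prod = σ ∧ w.length ≤ sepOne 1 σ + sepTwo 1 σ := by
  induction n with
  | zero => exact ⟨[], hyperoctahedral_ext fun k => k.elim0, Nat.zero_le _⟩
  | succ n ih =>
    obtain ⟨⟨τ, k, ε⟩, rfl⟩ := extend_mul_cosetRep_bijective.2 σ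
    obtain ⟨w, hw, hl⟩ := ih τ
    obtain ⟨u, hu, hm⟩ := exists_word_cosetRep k ε
    refine ⟨w.map Fin.castSucc ++ u, ?_, ?_⟩
    · rw [List.map_append, List.prod_append, hu, List.map_map]
      congr 1
      subst hw
      have : ∀ w : List (Fin n),
          (w.map (gen ∘ Fin.castSucc)).prod = extend (w.map gen).prod := by
        intro w
        induction w with
        | nil => simp [extend_one]
        | cons i w ih => simp [extend_mul, extend_gen, ih]
      exact this w
    · simp only [sepOne_extend_mul, sepTwo_extend_mul, List.length_append, List.length_map, hm]
      split_ifs <;> omega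

/-- Each letter count is at least its hyperplane count, while by minimality their sum is at most the
sum of the hyperplane counts. Both are thus equalities, and the counts do not depend on the reduced
word. -/
theorem countP_eq_of_isReducedWord {n : ℕ} {σ : hyperoctahedral n} {w : List (Fin n)}
    (h : IsReducedWord σ w) :
    w.countP (fun i => i.val = 0) = sepOne 1 σ ∧ w.countP (fun i => i.val ≠ 0) = sepTwo 1 σ := by
  obtain ⟨hw, hmin⟩ := h
  obtain ⟨u, hu, hl⟩ := exists_word_length_le σ
  have h1 := sepOne_prod_le w
  have h2 := sepTwo_prod_le w
  have h3 := hmin u hu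
  have h4 := List.length_eq_countP_add_countP (fun i : Fin n => decide (i.val = 0)) (l := w)
  have h5 : w.countP (fun i => decide (i.val ≠ 0)) =
      w.countP (fun i => decide ¬ decide (i.val = 0) = true) := by
    simp
  rw [hw] at h1 h2
  omega

theorem lOne_eq {n : ℕ} (σ : hyperoctahedral n) : lOne σ = sepOne 1 σ :=
  (countP_eq_of_isReducedWord (exists_reducedWord σ).choose_spec).1

theorem lTwo_eq {n : ℕ} (σ : hyperoctahedral n) : lTwo σ = sepTwo 1 σ :=
  (countP_eq_of_isReducedWord (exists_reducedWord σ).choose_spec).2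

theorem eq_one_of_sep_eq_zero {n : ℕ} {σ : hyperoctahedral n} (h1 : sepOne 1 σ = 0)
    (h2 : sepTwo 1 σ = 0) : σ = 1 := by
  obtain ⟨w, hw, hl⟩ := exists_word_length_le σ
  rw [h1, h2, add_zero, Nat.le_zero, List.length_eq_zero_iff] at hl
  subst hl
  exact hw.symm

/-! ## Invertibility of the symmetrization element in the group algebra -/

/-- The kernel on sign vectors in which every coordinate where two vectors differ contributes a
factor of absolute value less than one is nondegenerate. -/
theorem eq_zero_of_signKernel_mulVec_eq_zero {ι W : Type*} [Fintype ι] [Fintype W]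
    (c : ι → ℝ) (hc : ∀ i, |c i| < 1) (s : W → ι → ℝ) (hs : ∀ w i, s w i = 1 ∨ s w i = -1)
    (hinj : Function.Injective s) (a : W → ℝ)
    (h : ∀ w, ∑ v, (∏ i, if s w i = s v i then 1 else c i) * a v = 0) : a = 0 := by
  classical
  set χ : Finset ι → W → ℝ := fun A w => ∏ i ∈ A, s w i with hχ
  set m : Finset ι → ℝ := fun A =>
    (∏ i ∈ A, (1 - c i) / 2) * ∏ i ∈ Finset.univ \ A, (1 + c i) / 2 with hm
  have hmpos : ∀ A, 0 < m A := fun A => mul_pos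
    (Finset.prod_pos fun i _ => by linarith [(abs_lt.1 (hc i)).2])
    (Finset.prod_pos fun i _ => by linarith [(abs_lt.1 (hc i)).1])
  have hK : ∀ w v, (∏ i, if s w i = s v i then 1 else c i) = ∑ A, m A * (χ A w * χ A v) := by
    intro w v
    -- A two-point kernel is a combination of the two characters of the sign group, with positive
    -- coefficients because `|c i| < 1`; expanding the product gives the coefficients `m A`.
    have : ∀ i, (if s w i = s v i then 1 else c i) =
        (1 - c i) / 2 * (s w i * s v i) + (1 + c i) / 2 := by
      intro i
      rcases hs w i with h1 | h1 <;> rcases hs v i with h2 | h2 <;> rw [h1, h2] <;> norm_num <;>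
        ring
    simp only [this]
    rw [Finset.prod_add, Finset.powerset_univ]
    refine Finset.sum_congr rfl fun A _ => ?_
    simp only [hm, hχ, Finset.prod_mul_distrib]
    ring
  have hquad : ∑ A, m A * (∑ v, χ A v * a v) ^ 2 = 0 := by
    have : ∑ A, m A * (∑ v, χ A v * a v) ^ 2 =
        ∑ w, a w * ∑ v, (∏ i, if s w i = s v i then 1 else c i) * a v := by
      simp only [hK, sq, Finset.mul_sum, Finset.sum_mul]
      rw [Finset.sum_comm]
      refine Finset.sum_congr rfl fun w _ => ?_
      rw [Finset.sum_comm]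
      refine Finset.sum_congr rfl fun v _ => Finset.sum_congr rfl fun A _ => ?_
      ring
    rw [this]
    exact Finset.sum_eq_zero fun w _ => by rw [h, mul_zero]
  have hzero : ∀ A, ∑ v, χ A v * a v = 0 := by
    intro A
    have := (Finset.sum_eq_zero_iff_of_nonneg
      fun A _ => mul_nonneg (hmpos A).le (sq_nonneg _)).1 hquad A (Finset.mem_univ A)
    exact pow_eq_zero_iff two_ne_zero |>.1 ((mul_eq_zero.1 this).resolve_left (hmpos A).ne')
  funext w
  -- Orthogonality of characters: different sign vectors make some factor `s w i * s v i + 1`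
  -- vanish. Fourier inversion then recovers `a w`.
  have hdelta : ∀ v, ∑ A, χ A w * χ A v = if v = w then 2 ^ Fintype.card ι else 0 := by
    intro v
    have : ∑ A, χ A w * χ A v = ∏ i, (s w i * s v i + 1) := by
      rw [Finset.prod_add, Finset.powerset_univ]
      simp [hχ, Finset.prod_mul_distrib]
    rw [this]
    split_ifs with hv
    · subst hv
      have : ∀ i, s v i * s v i + 1 = 2 := by
        intro i
        rcases hs v i with h1 | h1 <;> rw [h1] <;> norm_num
      simp [this]
    · obtain ⟨i, hi⟩ := Function.ne_iff.1 fun e => hv (hinj e)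
      refine Finset.prod_eq_zero (Finset.mem_univ i) ?_
      rcases hs w i with h1 | h1 <;> rcases hs v i with h2 | h2 <;> simp_all
  have : ∑ A, χ A w * ∑ v, χ A v * a v = 2 ^ Fintype.card ι * a w := by
    simp only [Finset.mul_sum, ← mul_assoc]
    rw [Finset.sum_comm]
    simp only [← Finset.sum_mul, hdelta]
    simp
  simp only [hzero, mul_zero, Finset.sum_const_zero] at this
  exact (mul_eq_zero.1 this.symm).resolve_left (by positivity)

theorem exists_left_inverse_of_injective {W : Type*} [Fintype W] (K : W → W → ℝ)
    (hK : ∀ a : W → ℝ, (∀ w, ∑ v, K w v * a v = 0) → a = 0) (w₀ : W) :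
    ∃ b : W → ℝ, (∑ w, b w * K w w₀ = 1) ∧ ∀ v, v ≠ w₀ → ∑ w, b w * K w v = 0 := by
  classical
  let M : Matrix W W ℝ := Matrix.of K
  have hM : IsUnit M := by
    rw [← Matrix.mulVec_injective_iff_isUnit, ← Matrix.coe_mulVecLin, injective_iff_map_eq_zero]
    exact fun a ha => hK a fun w => congrFun ha w
  have h1 : M⁻¹ * M = 1 := Matrix.nonsing_inv_mul M ((Matrix.isUnit_iff_isUnit_det M).1 hM)
  refine ⟨fun w => M⁻¹ w₀ w, ?_, fun v hv => ?_⟩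
  · have := congrFun (congrFun h1 w₀) w₀
    rwa [Matrix.mul_apply, Matrix.one_apply_eq] at this
  · have := congrFun (congrFun h1 w₀) v
    rwa [Matrix.mul_apply, Matrix.one_apply_ne hv.symm] at this

/-- The weight `α^{l₁(σ)} q^{l₂(σ)}`. -/
noncomputable def weight (α q : ℝ) {n : ℕ} (σ : hyperoctahedral n) : ℝ :=
  α ^ lOne σ * q ^ lTwo σ

theorem sepOne_inv_mul {n : ℕ} (σ τ : hyperoctahedral n) : sepOne 1 (σ⁻¹ * τ) = sepOne σ τ := by
  rw [← sepOne_mul_left σ, mul_one, mul_inv_cancel_left]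

theorem sepTwo_inv_mul {n : ℕ} (σ τ : hyperoctahedral n) : sepTwo 1 (σ⁻¹ * τ) = sepTwo σ τ := by
  rw [← sepTwo_mul_left σ, mul_one, mul_inv_cancel_left]

open Classical in
/-- The sides of the reflecting hyperplanes on which the chamber of `σ` lies. -/
noncomputable def signVector {n : ℕ} (σ : hyperoctahedral n) :
    Fin n ⊕ (Fin n × Fin n × ℤˣ) → ℝ
  | .inl i => ((σ⁻¹.1 (i, 1)).2 : ℤ)
  | .inr (i, j, δ) => if i < j ∧ value (σ⁻¹.1 (i, 1)) < value (σ⁻¹.1 (j, δ)) then 1 else -1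

theorem signVector_inl {n : ℕ} (σ τ : hyperoctahedral n) (i : Fin n) :
    signVector σ (.inl i) = signVector τ (.inl i) ↔
      ¬ (σ⁻¹.1 (i, 1)).2 ≠ (τ⁻¹.1 (i, 1)).2 := by
  simp [signVector, Units.val_inj]

theorem signVector_inr {n : ℕ} (σ τ : hyperoctahedral n) (i j : Fin n) (δ : ℤˣ) :
    signVector σ (.inr (i, j, δ)) = signVector τ (.inr (i, j, δ)) ↔
      ¬ (i < j ∧ Separates σ τ (i, 1) (j, δ)) := by
  simp only [signVector, Separates]
  have : (1 : ℝ) ≠ -1 := by norm_num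
  by_cases h1 : i < j <;> by_cases h2 : value (σ⁻¹.1 (i, 1)) < value (σ⁻¹.1 (j, δ)) <;>
    by_cases h3 : value (τ⁻¹.1 (i, 1)) < value (τ⁻¹.1 (j, δ)) <;>
    simp only [h1, h2, h3, this, this.symm, and_true, and_false, if_true, if_false, iff_true,
      iff_false, not_true_eq_false, not_false_eq_true]

theorem signVector_eq_or {n : ℕ} (σ : hyperoctahedral n) (i) :
    signVector σ i = 1 ∨ signVector σ i = -1 := by
  rcases i with i | ⟨i, j, δ⟩
  · rcases Int.units_eq_one_or (σ⁻¹.1 (i, 1)).2 with h | h <;>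
      simp only [signVector, h] <;> simp
  · simp only [signVector]
    split_ifs <;> simp

theorem signVector_injective {n : ℕ} : Function.Injective (signVector (n := n)) := by
  intro σ τ h
  have h1 : sepOne σ τ = 0 := Finset.sum_eq_zero fun i _ =>
    if_neg ((signVector_inl σ τ i).1 (congrFun h _))
  have h2 : sepTwo σ τ = 0 := Finset.sum_eq_zero fun i _ => Finset.sum_eq_zero fun j _ =>
    Finset.sum_eq_zero fun δ _ => if_neg ((signVector_inr σ τ i j δ).1 (congrFun h _))
  rw [← sepOne_inv_mul] at h1
  rw [← sepTwo_inv_mul] at h2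
  exact inv_mul_eq_one.1 (eq_one_of_sep_eq_zero h1 h2)

open Classical in
-- Each separating hyperplane contributes one factor. Coordinates `(i, j, δ)` without `i < j` are
-- constantly `-1` and contribute `1`.
theorem weight_inv_mul (α q : ℝ) {n : ℕ} (σ τ : hyperoctahedral n) :
    weight α q (σ⁻¹ * τ) = ∏ i, if signVector σ i = signVector τ i then 1 else
      Sum.elim (fun _ => α) (fun _ => q) i := by
  rw [weight, lOne_eq, lTwo_eq, sepOne_inv_mul, sepTwo_inv_mul, Fintype.prod_sum_type]
  simp only [Fintype.prod_prod_type, signVector_inl, signVector_inr, sepOne, sepTwo,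
    ← Finset.prod_pow_eq_pow_sum, Sum.elim_inl, Sum.elim_inr]
  congr 1
  · refine Finset.prod_congr rfl fun i _ => ?_
    split_ifs <;> simp_all
  · refine Finset.prod_congr rfl fun i _ => Finset.prod_congr rfl fun j _ =>
      Finset.prod_congr rfl fun δ _ => ?_
    split_ifs <;> simp_all

/-- The sums are the coefficients at `1` and at `ρ` of a product in the group algebra, so `b` is a
left inverse of the symmetrization element. -/
theorem exists_weight_inverse {α q : ℝ} (hα : |α| < 1) (hq : |q| < 1) (n : ℕ) :
    ∃ b : hyperoctahedral n → ℝ, (∑ σ, b σ * weight α q (σ⁻¹ * 1) = 1) ∧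
      ∀ ρ, ρ ≠ 1 → ∑ σ, b σ * weight α q (σ⁻¹ * ρ) = 0 := by
  refine exists_left_inverse_of_injective (fun σ τ => weight α q (σ⁻¹ * τ)) (fun a ha => ?_) 1
  refine eq_zero_of_signKernel_mulVec_eq_zero (Sum.elim (fun _ => α) (fun _ => q)) ?_
    signVector signVector_eq_or signVector_injective a fun w => ?_
  · rintro (i | i)
    · exact hα
    · exact hq
  · have := ha w
    simp only [weight_inv_mul] at this
    convert this

theorem weight_extend_mul (α q : ℝ) {n : ℕ} (τ : hyperoctahedral n) (k : Fin (n + 1)) (ε : ℤˣ) :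
    weight α q (extend τ * cosetRep k ε) =
      weight α q τ * if ε = 1 then q ^ (n - k.val) else α * q ^ (n + k.val) := by
  simp only [weight, lOne_eq, lTwo_eq, sepOne_extend_mul, sepTwo_extend_mul]
  split_ifs <;> ring

open scoped TensorProduct DirectSum

section Fock

variable {H : Type*} [NormedAddCommGroup H] [InnerProductSpace ℂ H]

theorem linearMap_comp_sum {R M N P ι : Type*} [Semiring R] [AddCommMonoid M] [AddCommMonoid N]
    [AddCommMonoid P] [Module R M] [Module R N] [Module R P] (s : Finset ι) (g : N →ₗ[R] P)
    (f : ι → M →ₗ[R] N) : g ∘ₗ (∑ i ∈ s, f i) = ∑ i ∈ s, g ∘ₗ f i := by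
  ext x
  simp

theorem linearMap_sum_comp {R M N P ι : Type*} [Semiring R] [AddCommMonoid M] [AddCommMonoid N]
    [AddCommMonoid P] [Module R M] [Module R N] [Module R P] (s : Finset ι) (g : ι → N →ₗ[R] P)
    (f : M →ₗ[R] N) : (∑ i ∈ s, g i) ∘ₗ f = ∑ i ∈ s, g i ∘ₗ f := by
  ext x
  simp

/-! ## Nondegeneracy -/

theorem symmetrizer_eq (J : H →ₗ[ℂ] H) (α q : ℝ) (n : ℕ) :
    symmetrizer J α q n = ∑ σ : hyperoctahedral n, (weight α q σ : ℂ) • act J σ := rfl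

theorem symmetrizer_injective (J : H →ₗ[ℂ] H) (hJ : Function.Involutive J) {α q : ℝ}
    (hα : |α| < 1) (hq : |q| < 1) (n : ℕ) : Function.Injective (symmetrizer J α q n) := by
  classical
  obtain ⟨b, hb1, hb0⟩ := exists_weight_inverse hα hq n
  have h : (∑ σ, (b σ : ℂ) • act J σ) ∘ₗ symmetrizer J α q n = LinearMap.id := by
    have h1 : ∀ σ, act J σ ∘ₗ symmetrizer J α q n =
        ∑ ρ, (weight α q (σ⁻¹ * ρ) : ℂ) • act J ρ := by
      intro σ
      rw [symmetrizer_eq, linearMap_comp_sum, ← Equiv.sum_comp (Equiv.mulLeft σ)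
        (fun ρ => (weight α q (σ⁻¹ * ρ) : ℂ) • act J ρ)]
      refine Finset.sum_congr rfl fun τ _ => ?_
      rw [Equiv.coe_mulLeft, inv_mul_cancel_left, act_mul J hJ, LinearMap.comp_smul]
    have h2 : ∀ ρ, ρ ≠ 1 →
        (∑ σ, (b σ : ℂ) * (weight α q (σ⁻¹ * ρ) : ℂ)) • act J ρ = 0 := by
      intro ρ hρ
      have : (∑ σ, (b σ : ℂ) * (weight α q (σ⁻¹ * ρ) : ℂ)) = 0 := by
        exact_mod_cast congrArg (fun r : ℝ => (r : ℂ)) (hb0 ρ hρ)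
      rw [this, zero_smul]
    have h3 : (∑ σ, (b σ : ℂ) * (weight α q (σ⁻¹ * 1) : ℂ)) = 1 := by
      exact_mod_cast congrArg (fun r : ℝ => (r : ℂ)) hb1
    rw [linearMap_sum_comp]
    simp only [LinearMap.smul_comp, h1, Finset.smul_sum, smul_smul]
    rw [Finset.sum_comm]
    simp only [← Finset.sum_smul]
    rw [Finset.sum_eq_single 1 (fun ρ _ hρ => h2 ρ hρ) (fun h => absurd (Finset.mem_univ _) h),
      h3, one_smul, act_one]
  exact Function.LeftInverse.injective fun u => LinearMap.congr_fun h u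

/-- The orthogonal projection onto a finite-dimensional subspace. -/
noncomputable def finProj (S : Submodule ℂ H) [FiniteDimensional ℂ S] : H →ₗ[ℂ] H :=
  S.starProjection.toLinearMap

/-- An algebraic tensor involves finitely many vectors. Allowing every larger `T` lets sums be
handled by `S ⊔ S'`. -/
theorem exists_finProj_fixes {n : ℕ} (u : ⨂[ℂ]^n H) :
    ∃ S : Submodule ℂ H, ∃ _ : FiniteDimensional ℂ S, ∀ (T : Submodule ℂ H)
      (_ : FiniteDimensional ℂ T), S ≤ T → PiTensorProduct.map (fun _ => finProj T) u = u := by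
  induction u using PiTensorProduct.induction_on with
  | smul_tprod r v =>
    refine ⟨Submodule.span ℂ (Set.range v), FiniteDimensional.span_of_finite ℂ
      (Set.finite_range v), fun T _ hT => ?_⟩
    rw [map_smul, PiTensorProduct.map_tprod]
    congr 2
    funext i
    exact Submodule.starProjection_eq_self_iff.2 (hT (Submodule.subset_span ⟨i, rfl⟩))
  | add a b ha hb =>
    obtain ⟨S, hS, h1⟩ := ha
    obtain ⟨S', hS', h2⟩ := hb
    refine ⟨S ⊔ S', inferInstance, fun T hT hle => ?_⟩
    rw [map_add, h1 T hT (le_sup_left.trans hle), h2 T hT (le_sup_right.trans hle)]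

/-- In an orthonormal basis of `S` the tensor power of the projection expands with coefficients
`innerFunctional`, all zero on `u`. -/
theorem map_finProj_eq_zero {n : ℕ} (S : Submodule ℂ H) [FiniteDimensional ℂ S] (u : ⨂[ℂ]^n H)
    (h : ∀ v, innerFunctional v u = 0) : PiTensorProduct.map (fun _ => finProj S) u = 0 := by
  classical
  let e := stdOrthonormalBasis ℂ S
  have hmap : PiTensorProduct.map (fun _ : Fin n => finProj S) =
      ∑ m : Fin n → Fin (Module.finrank ℂ S), (innerFunctional fun i => (e (m i) : H)).smulRight
        (PiTensorProduct.tprod ℂ fun i => (e (m i) : H)) := by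
    apply PiTensorProduct.ext
    ext v
    simp only [LinearMap.compMultilinearMap_apply, PiTensorProduct.map_tprod]
    have hp : ∀ x : H, finProj S x = ∑ j, inner ℂ (e j : H) x • (e j : H) := by
      intro x
      have := congrArg (fun y : S => (y : H)) (e.orthogonalProjectionOnto_apply_eq_sum x)
      simpa [finProj] using this
    simp only [hp]
    rw [MultilinearMap.map_sum, LinearMap.sum_apply]
    refine Finset.sum_congr rfl fun m _ => ?_
    rw [MultilinearMap.map_smul_univ, LinearMap.smulRight_apply, innerFunctional_tprod]
  rw [hmap, LinearMap.sum_apply]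
  exact Finset.sum_eq_zero fun m _ => by rw [LinearMap.smulRight_apply, h, zero_smul]

theorem tensorInner_tprod_left {n : ℕ} (v : Fin n → H) :
    tensorInner n (PiTensorProduct.tprod ℂ v) = innerFunctional v := by
  apply PiTensorProduct.ext
  ext y
  simp only [LinearMap.compMultilinearMap_apply, tensorInner_tprod, innerFunctional_tprod]

theorem eq_zero_of_tensorInner_eq_zero {n : ℕ} {u : ⨂[ℂ]^n H}
    (h : ∀ f, tensorInner n f u = 0) : u = 0 := by
  obtain ⟨S, hS, hu⟩ := exists_finProj_fixes u
  rw [← hu S hS le_rfl]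
  exact map_finProj_eq_zero S u fun v => by rw [← tensorInner_tprod_left, h]

/-! ## The recursion for the symmetrization operator -/

theorem tensorInner_appendRight (x : H) {n : ℕ} (f : ⨂[ℂ]^n H) (u : ⨂[ℂ]^(n + 1) H) :
    tensorInner (n + 1) (appendRight x n f) u = tensorInner n f (contract x (Fin.last n) u) := by
  induction f using PiTensorProduct.induction_on with
  | smul_tprod r v =>
    simp only [map_smul, map_smulₛₗ, LinearMap.smul_apply]
    congr 1
    rw [appendRight_tprod]
    have : tensorInner (n + 1) (PiTensorProduct.tprod ℂ (Fin.snoc v x : Fin (n + 1) → H)) =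
        tensorInner n (PiTensorProduct.tprod ℂ v) ∘ₗ contract x (Fin.last n) := by
      apply PiTensorProduct.ext
      refine MultilinearMap.ext fun (y : Fin (n + 1) → H) => ?_
      simp only [LinearMap.compMultilinearMap_apply, LinearMap.comp_apply, contract_tprod,
        map_smul, tensorInner_tprod, Fin.prod_univ_castSucc, Fin.snoc_castSucc, Fin.snoc_last,
        Fin.succAbove_last_apply, smul_eq_mul]
      ring
    rw [this, LinearMap.comp_apply]
  | add a b ha hb => simp only [map_add, LinearMap.add_apply, ha, hb]

theorem contract_comp_act_extend (J : H →ₗ[ℂ] H) (x : H) {n : ℕ} (τ : hyperoctahedral n) :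
    contract x (Fin.last n) ∘ₗ act J (extend τ) = act J τ ∘ₗ contract x (Fin.last n) := by
  apply PiTensorProduct.ext
  refine MultilinearMap.ext fun (v : Fin (n + 1) → H) => ?_
  simp only [LinearMap.compMultilinearMap_apply, LinearMap.comp_apply, act_tprod, contract_tprod,
    map_smul, ← extend_inv, extend_last, Fin.succAbove_last_apply, extend_castSucc]
  simp [signOp]

theorem inner_signOp {J : H →ₗ[ℂ] H} (hJ : J.IsSymmetric) (ε : ℤˣ) (x y : H) :
    inner ℂ x (signOp J ε y) = inner ℂ (signOp J ε x) y := by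
  unfold signOp
  split_ifs
  · rfl
  · exact (hJ x y).symm

/-- The representative moves factor `k` to the end and keeps the order of the others; symmetry of
`J` shifts the sign from that factor to `x`. -/
theorem contract_comp_act_cosetRep {J : H →ₗ[ℂ] H} (hJ : J.IsSymmetric) (x : H) {n : ℕ}
    (k : Fin (n + 1)) (ε : ℤˣ) :
    contract x (Fin.last n) ∘ₗ act J (cosetRep k ε) = contract (signOp J ε x) k := by
  apply PiTensorProduct.ext
  refine MultilinearMap.ext fun (v : Fin (n + 1) → H) => ?_
  simp only [LinearMap.compMultilinearMap_apply, LinearMap.comp_apply, act_tprod, contract_tprod,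
    cosetRep_inv_last, Fin.succAbove_last_apply, cosetRep_inv_castSucc, one_mul, inner_signOp hJ]
  simp [signOp]

/-- The component `H^{⊗(n+1)} → H^{⊗n}` of the annihilation operator. -/
noncomputable def annihilate (J : H →ₗ[ℂ] H) (α q : ℝ) (x : H) (n : ℕ) :
    (⨂[ℂ]^(n + 1) H) →ₗ[ℂ] (⨂[ℂ]^n H) :=
  ∑ k : Fin (n + 1), ((q : ℂ) ^ (n - k.val) • contract x k +
    ((α : ℂ) * (q : ℂ) ^ (n + k.val)) • contract (J x) k)

theorem contract_comp_symmetrizer {J : H →ₗ[ℂ] H} (hJ : J.IsSymmetric)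
    (hJ' : Function.Involutive J) (α q : ℝ) (x : H) (n : ℕ) :
    contract x (Fin.last n) ∘ₗ symmetrizer J α q (n + 1) =
      symmetrizer J α q n ∘ₗ annihilate J α q x n := by
  have hterm : ∀ (τ : hyperoctahedral n) (k : Fin (n + 1)) (ε : ℤˣ),
      contract x (Fin.last n) ∘ₗ ((weight α q (extend τ * cosetRep k ε) : ℂ) •
        act J (extend τ * cosetRep k ε)) = (weight α q τ : ℂ) • act J τ ∘ₗ
          (((if ε = 1 then q ^ (n - k.val) else α * q ^ (n + k.val) : ℝ) : ℂ) •
            contract (signOp J ε x) k) := by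
    intro τ k ε
    rw [weight_extend_mul, act_mul J hJ', LinearMap.comp_smul, ← LinearMap.comp_assoc,
      contract_comp_act_extend, LinearMap.comp_assoc, contract_comp_act_cosetRep hJ,
      LinearMap.comp_smul, smul_smul, Complex.ofReal_mul]
  have hann : annihilate J α q x n = ∑ k : Fin (n + 1), ∑ ε : ℤˣ,
      ((if ε = 1 then q ^ (n - k.val) else α * q ^ (n + k.val) : ℝ) : ℂ) •
        contract (signOp J ε x) k := by
    have hu : (-1 : ℤˣ) ≠ 1 := by decide
    refine Finset.sum_congr rfl fun k _ => ?_
    rw [sum_units, if_pos rfl, if_neg hu]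
    simp [signOp, hu]
  rw [symmetrizer_eq, ← Equiv.sum_comp (Equiv.ofBijective _ extend_mul_cosetRep_bijective),
    linearMap_comp_sum, Fintype.sum_prod_type, symmetrizer_eq, linearMap_sum_comp]
  refine Finset.sum_congr rfl fun τ _ => ?_
  rw [Fintype.sum_prod_type, hann, LinearMap.smul_comp, linearMap_comp_sum, Finset.smul_sum]
  refine Finset.sum_congr rfl fun k _ => ?_
  rw [linearMap_comp_sum, Finset.smul_sum]
  exact Finset.sum_congr rfl fun ε _ => hterm τ k ε

/-! ## Operators on the Fock space -/

theorem lowering_lof_zero (D : ∀ n : ℕ, (⨂[ℂ]^(n + 1) H) →ₗ[ℂ] (⨂[ℂ]^n H)) (u : ⨂[ℂ]^0 H) :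
    lowering D (DirectSum.lof ℂ ℕ (fun n => ⨂[ℂ]^n H) 0 u) = 0 := by
  rw [lowering, DirectSum.toModule_lof]
  rfl

theorem lowering_lof_succ (D : ∀ n : ℕ, (⨂[ℂ]^(n + 1) H) →ₗ[ℂ] (⨂[ℂ]^n H)) (n : ℕ)
    (u : ⨂[ℂ]^(n + 1) H) :
    lowering D (DirectSum.lof ℂ ℕ (fun n => ⨂[ℂ]^n H) (n + 1) u) =
      DirectSum.lof ℂ ℕ (fun n => ⨂[ℂ]^n H) n (D n u) := by
  rw [lowering, DirectSum.toModule_lof]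
  rfl

theorem fock_ext {S T : Fock H →ₗ[ℂ] Fock H}
    (h0 : ∀ u, S (DirectSum.lof ℂ ℕ (fun n => ⨂[ℂ]^n H) 0 u) =
      T (DirectSum.lof ℂ ℕ (fun n => ⨂[ℂ]^n H) 0 u))
    (h1 : ∀ n u, S (DirectSum.lof ℂ ℕ (fun n => ⨂[ℂ]^n H) (n + 1) u) =
      T (DirectSum.lof ℂ ℕ (fun n => ⨂[ℂ]^n H) (n + 1) u)) : S = T := by
  refine DirectSum.linearMap_ext ℂ fun n => LinearMap.ext fun u => ?_
  cases n with
  | zero => exact h0 u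
  | succ n => exact h1 n u

theorem lowering_apply (D : ∀ n : ℕ, (⨂[ℂ]^(n + 1) H) →ₗ[ℂ] (⨂[ℂ]^n H)) (g : Fock H) (n : ℕ) :
    lowering D g n = D n (g (n + 1)) := by
  have : DirectSum.component ℂ ℕ (fun n => ⨂[ℂ]^n H) n ∘ₗ lowering D =
      D n ∘ₗ DirectSum.component ℂ ℕ (fun n => ⨂[ℂ]^n H) (n + 1) := by
    refine DirectSum.linearMap_ext ℂ fun m => LinearMap.ext fun u => ?_
    simp only [LinearMap.comp_apply]
    cases m with
    | zero =>
      rw [lowering_lof_zero, map_zero, DirectSum.component.of, dif_neg (by omega), map_zero]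
    | succ m =>
      rw [lowering_lof_succ, DirectSum.component.of, DirectSum.component.of]
      by_cases h : m = n
      · subst h
        simp
      · rw [dif_neg h, dif_neg (by omega), map_zero]
  exact LinearMap.congr_fun this g

theorem creation_apply_zero (x : H) (f : Fock H) : creation x f 0 = 0 := by
  have : DirectSum.component ℂ ℕ (fun n => ⨂[ℂ]^n H) 0 ∘ₗ creation x = 0 := by
    refine DirectSum.linearMap_ext ℂ fun m => LinearMap.ext fun u => ?_
    simp only [LinearMap.comp_apply, creation, DirectSum.toModule_lof]
    rw [DirectSum.component.of, dif_neg (by omega)]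
    rfl
  exact LinearMap.congr_fun this f

theorem creation_apply_succ (x : H) (f : Fock H) (n : ℕ) :
    creation x f (n + 1) = appendRight x n (f n) := by
  have : DirectSum.component ℂ ℕ (fun n => ⨂[ℂ]^n H) (n + 1) ∘ₗ creation x =
      appendRight x n ∘ₗ DirectSum.component ℂ ℕ (fun n => ⨂[ℂ]^n H) n := by
    refine DirectSum.linearMap_ext ℂ fun m => LinearMap.ext fun u => ?_
    simp only [LinearMap.comp_apply, creation, DirectSum.toModule_lof]
    rw [DirectSum.component.of, DirectSum.component.of]
    by_cases h : m = n
    · subst h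
      simp
    · rw [dif_neg h, dif_neg (by omega), map_zero]
  exact LinearMap.congr_fun this f

theorem fockInner_eq_sum (J : H →ₗ[ℂ] H) (α q : ℝ) (f g : Fock H) (s : Finset ℕ)
    (hs : ∀ n, n ∉ s → f n = 0) :
    fockInner J α q f g = ∑ n ∈ s, tensorInner n (f n) (symmetrizer J α q n (g n)) := by
  classical
  unfold fockInner
  refine Finset.sum_subset (fun n hn => ?_) (fun n _ hn => ?_)
  · by_contra h
    exact (DFinsupp.mem_support_iff.1 hn) (hs n h)
  · rw [DFinsupp.notMem_support_iff.1 hn, map_zero, LinearMap.zero_apply]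

theorem exists_range_support (f : Fock H) : ∃ N, ∀ n, N ≤ n → f n = 0 := by
  classical
  refine ⟨(DFinsupp.support f).sup id + 1, fun n hn => ?_⟩
  by_contra h
  have := Finset.le_sup (f := id) (DFinsupp.mem_support_iff.2 h)
  simp only [id] at this
  omega

theorem isAnnihilation_lowering {J : H →ₗ[ℂ] H} (hJ : J.IsSymmetric)
    (hJ' : Function.Involutive J) (α q : ℝ) (x : H) :
    IsAnnihilation J α q x (lowering (annihilate J α q x)) := by
  intro f g
  obtain ⟨N, hN⟩ := exists_range_support f
  -- Creation raises the degree by one, so the second sum needs one more term; its degree zero term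
  -- vanishes and the rest match after a shift.
  rw [fockInner_eq_sum J α q f _ (Finset.range N) (fun n hn => hN n (by simpa using hn)),
    fockInner_eq_sum J α q (creation x f) g (Finset.range (N + 1)), Finset.sum_range_succ',
    creation_apply_zero, map_zero, LinearMap.zero_apply, add_zero]
  · refine Finset.sum_congr rfl fun n _ => ?_
    rw [lowering_apply, creation_apply_succ, tensorInner_appendRight]
    exact congrArg (tensorInner n (f n))
      (LinearMap.congr_fun (contract_comp_symmetrizer hJ hJ' α q x n) (g (n + 1))).symm
  · intro n hn
    cases n with
    | zero => exact absurd hn (by simp)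
    | succ n => rw [creation_apply_succ, hN n (by simpa using hn), map_zero]

theorem eq_of_fockInner_eq {J : H →ₗ[ℂ] H} (hJ : Function.Involutive J) {α q : ℝ}
    (hα : |α| < 1) (hq : |q| < 1) {g h : Fock H}
    (hgh : ∀ f, fockInner J α q f g = fockInner J α q f h) : g = h := by
  classical
  refine DFinsupp.ext fun n => symmetrizer_injective J hJ hα hq n (sub_eq_zero.1 ?_)
  refine eq_zero_of_tensorInner_eq_zero fun u => ?_
  have key : ∀ g : Fock H, fockInner J α q (DirectSum.lof ℂ ℕ (fun n => ⨂[ℂ]^n H) n u) g =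
      tensorInner n u (symmetrizer J α q n (g n)) := by
    intro g
    rw [fockInner_eq_sum J α q _ g {n}, Finset.sum_singleton, DirectSum.lof_apply]
    intro m hm
    exact DirectSum.of_eq_of_ne _ _ _ (by simpa using hm)
  rw [map_sub, ← key, ← key, hgh, sub_self]

theorem isAnnihilation_iff {J : H →ₗ[ℂ] H} (hJ : J.IsSymmetric) (hJ' : Function.Involutive J)
    {α q : ℝ} (hα : |α| < 1) (hq : |q| < 1) (x : H) (T : Fock H →ₗ[ℂ] Fock H) :
    IsAnnihilation J α q x T ↔ T = lowering (annihilate J α q x) := by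
  constructor
  · intro hT
    refine LinearMap.ext fun g => eq_of_fockInner_eq hJ' hα hq fun f => ?_
    rw [hT f g, isAnnihilation_lowering hJ hJ' α q x f g]
  · rintro rfl
    exact isAnnihilation_lowering hJ hJ' α q x

/-! ### The closed formula and its special cases -/

theorem qPowNumberSubOne_lof_succ (q : ℝ) (n : ℕ) (u : ⨂[ℂ]^(n + 1) H) :
    qPowNumberSubOne H q (DirectSum.lof ℂ ℕ (fun n => ⨂[ℂ]^n H) (n + 1) u) =
      (q : ℂ) ^ n • DirectSum.lof ℂ ℕ (fun n => ⨂[ℂ]^n H) (n + 1) u := by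
  rw [qPowNumberSubOne, numberFun, DirectSum.toModule_lof, LinearMap.smul_apply]
  simp

theorem qPowNumberSubOne_lof_zero (q : ℝ) (u : ⨂[ℂ]^0 H) :
    qPowNumberSubOne H q (DirectSum.lof ℂ ℕ (fun n => ⨂[ℂ]^n H) 0 u) =
      (q : ℂ) ^ (-1 : ℤ) • DirectSum.lof ℂ ℕ (fun n => ⨂[ℂ]^n H) 0 u := by
  rw [qPowNumberSubOne, numberFun, DirectSum.toModule_lof, LinearMap.smul_apply]
  simp

/-- On degree `n + 1` the operator `q^{N-1}` is `q^n`, the common factor of the weights `q^{n+k}`.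
On the vacuum its value is killed by the left annihilation. -/
theorem lowering_annihilate (J : H →ₗ[ℂ] H) (α q : ℝ) (x : H) :
    lowering (annihilate J α q x) = rightAnnihilation q x +
      (α : ℂ) • (leftAnnihilation q (J x) ∘ₗ qPowNumberSubOne H q) := by
  refine fock_ext (fun u => ?_) (fun n u => ?_)
  · simp only [LinearMap.add_apply, LinearMap.smul_apply, LinearMap.comp_apply,
      qPowNumberSubOne_lof_zero, map_smul, rightAnnihilation, leftAnnihilation, lowering_lof_zero,
      smul_zero, add_zero]
  · simp only [LinearMap.add_apply, LinearMap.smul_apply, LinearMap.comp_apply,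
      qPowNumberSubOne_lof_succ, map_smul, rightAnnihilation, leftAnnihilation, lowering_lof_succ]
    rw [← map_smul, ← map_smul, ← map_add]
    congr 1
    simp only [annihilate, LinearMap.sum_apply, LinearMap.add_apply, LinearMap.smul_apply,
      Finset.sum_add_distrib, Finset.smul_sum, smul_smul, pow_add]

theorem rightAnnihilation_zero (x : H) : rightAnnihilation 0 x = freeRight x := by
  unfold rightAnnihilation freeRight
  congr 1
  funext n
  rw [Finset.sum_eq_single (Fin.last n)]
  · simp
  · intro k _ hk
    have : n - k.val ≠ 0 := by
      have := Fin.val_lt_last hk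
      omega
    rw [Complex.ofReal_zero, zero_pow this, zero_smul]
  · simp

theorem leftAnnihilation_zero (x : H) : leftAnnihilation 0 x = freeLeft x := by
  unfold leftAnnihilation freeLeft
  congr 1
  funext n
  rw [Finset.sum_eq_single 0]
  · simp
  · intro k _ hk
    have : k.val ≠ 0 := fun e => hk (Fin.ext e)
    rw [Complex.ofReal_zero, zero_pow this, zero_smul]
  · simp

theorem leftAnnihilation_eq {q : ℝ} (hq : q ≠ 0) (x : H) :
    leftAnnihilation q x = rightAnnihilation (1 / q) x ∘ₗ qPowNumberSubOne H q := by
  have hq' : (q : ℂ) ≠ 0 := Complex.ofReal_ne_zero.2 hq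
  refine fock_ext (fun u => ?_) (fun n u => ?_)
  · simp only [LinearMap.comp_apply, qPowNumberSubOne_lof_zero, map_smul, rightAnnihilation,
      leftAnnihilation, lowering_lof_zero, smul_zero]
  · simp only [LinearMap.comp_apply, qPowNumberSubOne_lof_succ, map_smul, rightAnnihilation,
      leftAnnihilation, lowering_lof_succ]
    rw [← map_smul]
    congr 1
    simp only [LinearMap.sum_apply, LinearMap.smul_apply, Finset.smul_sum, smul_smul]
    refine Finset.sum_congr rfl fun k _ => ?_
    congr 1
    -- With `n = k + m` the claim is `q^k = q^(k+m) (1/q)^m`.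
    obtain ⟨m, hm⟩ := Nat.exists_eq_add_of_le (Nat.lt_succ_iff.1 k.isLt)
    rw [show n - k.val = m by omega]
    conv_rhs => rw [hm]
    rw [pow_add, Complex.ofReal_div, Complex.ofReal_one, one_div, inv_pow, mul_assoc,
      mul_inv_cancel₀ (pow_ne_zero m hq'), mul_one]

end Fock

end TypeB

theorem mainTheorem4 {H : Type*} [NormedAddCommGroup H] [InnerProductSpace ℂ H]
    (J : H →ₗ[ℂ] H) (hJsymm : J.IsSymmetric) (hJinv : Function.Involutive J)
    (α q : ℝ) (hα : α ∈ Set.Ioo (-1 : ℝ) 1) (hq : q ∈ Set.Ioo (-1 : ℝ) 1) (x : H) :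
    (∀ T : TypeB.Fock H →ₗ[ℂ] TypeB.Fock H,
      TypeB.IsAnnihilation J α q x T ↔
        T = TypeB.rightAnnihilation q x +
          (α : ℂ) • (TypeB.leftAnnihilation q (J x) ∘ₗ TypeB.qPowNumberSubOne H q)) ∧
    TypeB.rightAnnihilation 0 x = TypeB.freeRight x ∧
    TypeB.leftAnnihilation 0 x = TypeB.freeLeft x ∧
    (q ≠ 0 → TypeB.leftAnnihilation q x =
      TypeB.rightAnnihilation (1 / q) x ∘ₗ TypeB.qPowNumberSubOne H q) := by
  refine ⟨fun T => ?_, TypeB.rightAnnihilation_zero x, TypeB.leftAnnihilation_zero x,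
    fun h => TypeB.leftAnnihilation_eq h x⟩
  rw [TypeB.isAnnihilation_iff hJsymm hJinv (abs_lt.2 hα) (abs_lt.2 hq),
    TypeB.lowering_annihilate]
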